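/- A parameterized problem consists of instances $x$, encoded injectively as bit strings, a set of yes-instances, and a parameter $\kappa(x)\in\mathbb N$ for each instance. It admits a polynomial kernel if there are a map $f$ from instances to instances, computable by a (deterministic multi-tape) Turing machine in time polynomial in the length of the encoding of $x$, and a polynomial $p$ such that for every instance $x$: $x$ is a yes-instance if and only if $f(x)$ is one, and the length of the encoding of $f(x)$ plus $\kappa(f(x))$ is at most $p(\kappa(x))$. Let $G=(V,E)$ be a finite simple undirected graph. A set $S\subseteq V$ is a twin-cover of $G$ if $G-S$ is a disjoint union of complete graphs and any two vertices $u,v$ in the same connected component of $G-S$ satisfy $N(u)\cap S=N(v)\cap S$. Let $tc(G)$ denote the minimum cardinality of a twin-cover of $G$. Consider instances $(G,k)$, where $G$ is a finite graph and $k\in\mathbb N$ (with $G$ encoded by its number of vertices in unary and its adjacency matrix, and $k$ in binary), with parameter $tc(G)$. Vertex Cover$(tc)$ asks whether there is a set $X$ of at most $k$ vertices such that every edge of $G$ has at least one endpoint in $X$. Odd Cycle Transversal$(tc)$ asks whether there is a set $X$ of at most $k$ vertices such that $G-X$ is bipartite. Theorem. Vertex Cover$(tc)$ and Odd Cycle Transversal$(tc)$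 both admit polynomial kernels. -/

import Mathlib

/-- A graph is a cluster graph (a disjoint union of complete graphs) if any two distinct vertices
in the same connected component are adjacent. -/
def SimpleGraph.IsClusterGraph {V : Type*} (G : SimpleGraph V) : Prop :=
  ∀ u v : V, G.Reachable u v → u ≠ v → G.Adj u v

/-- `S` is a twin-cover of `G` if `G - S` is a cluster graph and any two vertices `u`, `v` in the
same connected component of `G - S` satisfy `N(u) ∩ S = N(v) ∩ S`. -/
def SimpleGraph.IsTwinCover {V : Type*} (G : SimpleGraph V) (S : Set V) : Prop :=
  (G.induce Sᶜ).IsClusterGraph ∧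
    ∀ u v : ↥(Sᶜ), (G.induce Sᶜ).Reachable u v →
      G.neighborSet (u : V) ∩ S = G.neighborSet (v : V) ∩ S

/-- The whole vertex set is a twin-cover, so the minimum below is over a non-empty set. -/
theorem SimpleGraph.isTwinCover_univ {V : Type*} (G : SimpleGraph V) :
    G.IsTwinCover Set.univ :=
  ⟨fun u => absurd (Set.mem_univ (u : V)) u.2, fun u => absurd (Set.mem_univ (u : V)) u.2⟩

/-- The twin-cover number `tc(G)`: the minimum cardinality of a twin-cover of `G`. -/
noncomputable def SimpleGraph.twinCoverNum {V : Type*} [Fintype V] (G : SimpleGraph V) : ℕ :=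
  sInf {m : ℕ | ∃ S : Finset V, G.IsTwinCover (S : Set V) ∧ S.card = m}

/-- `S` is an odd cycle transversal of `G` if `G - S` is bipartite. -/
def SimpleGraph.IsOddCycleTransversal {V : Type*} (G : SimpleGraph V) (S : Set V) : Prop :=
  (G.induce Sᶜ).IsBipartite

/-- An input `(G, k)`: a finite graph on the vertex set `{0, …, n - 1}` and a number `k`. -/
structure GraphBudget where
  n : ℕ
  graph : SimpleGraph (Fin n)
  budget : ℕ

/-- The adjacency matrix of `G`, as a list of bits, row by row. -/
noncomputable def adjacencyBits {n : ℕ} (G : SimpleGraph (Fin n)) : List Bool :=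
  open Classical in
  (List.finRange n).flatMap fun i => (List.finRange n).map fun j => decide (G.Adj i j)

/-- The encoding of `(G, k)` as a bit string: the number `n` of vertices in unary, terminated by a
`false`, then the `n²` bits of the adjacency matrix, then `k` in binary. -/
noncomputable def GraphBudget.encode (x : GraphBudget) : List Bool :=
  List.replicate x.n true ++ false :: (adjacencyBits x.graph ++ Computability.encodeNat x.budget)

/-- A parameterized decision problem: a set of instances, encoded as bit strings, the
yes-instances among them, and the parameter of each instance. -/
structure ParameterizedProblem where
  /-- The instances. -/
  Instance : Type
  /-- The encoding of the instances as bit strings. -/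
  encode : Instance → List Bool
  /-- Distinct instances have distinct encodings. -/
  encode_injective : Function.Injective encode
  /-- The yes-instances. -/
  IsYes : Instance → Prop
  /-- The parameter of an instance. -/
  parameter : Instance → ℕ

/-- `Q` admits a polynomial kernel: there is a map `f` from instances to instances, computable by
a (multi-tape) Turing machine in time polynomial in the length of the encoded instance, such that
`x` is a yes-instance iff `f x` is, and such that the size of `f x` together with its
parameter is bounded by a polynomial in the parameter of `x`. -/
def ParameterizedProblem.HasPolynomialKernel (Q : ParameterizedProblem) : Prop :=
  ∃ f : Q.Instance → Q.Instance,
    Nonempty (Turing.TM2ComputableInPolyTime Q.encode Q.encode f) ∧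
    (∀ x, Q.IsYes x ↔ Q.IsYes (f x)) ∧
    ∃ p : Polynomial ℕ, ∀ x,
      (Q.encode (f x)).length + Q.parameter (f x) ≤ p.eval (Q.parameter x)

theorem adjacencyBits_length {n : ℕ} (G : SimpleGraph (Fin n)) :
    (adjacencyBits G).length = n * n := by
  simp [adjacencyBits, List.length_flatMap]

theorem adjacencyBits_injective {n : ℕ} :
    Function.Injective (adjacencyBits : SimpleGraph (Fin n) → List Bool) := by
  classical
  intro G H h
  have key : ∀ l : List (Fin n),
      (l.flatMap fun i => (List.finRange n).map fun j => decide (G.Adj i j)) =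
        (l.flatMap fun i => (List.finRange n).map fun j => decide (H.Adj i j)) →
      ∀ i ∈ l, ∀ j, (G.Adj i j ↔ H.Adj i j) := by
    intro l
    induction l with
    | nil => intro _ i hi; simp at hi
    | cons a l ih =>
      intro hl
      rw [List.flatMap_cons, List.flatMap_cons] at hl
      obtain ⟨h1, h2⟩ := List.append_inj hl (by simp)
      intro i hi j
      rcases List.mem_cons.1 hi with rfl | hi
      · have := (List.map_inj_left.1 h1) j (List.mem_finRange j)
        simpa using this
      · exact ih h2 i hi j
  ext i j
  refine key (List.finRange n) ?_ i (List.mem_finRange i) j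
  unfold adjacencyBits at h
  convert h using 5

theorem replicate_true_append_false_inj {m n : ℕ} {s t : List Bool}
    (h : List.replicate m true ++ false :: s = List.replicate n true ++ false :: t) :
    m = n ∧ s = t := by
  induction m generalizing n with
  | zero =>
    cases n with
    | zero => simpa using h
    | succ n => simp [List.replicate_succ] at h
  | succ m ih =>
    cases n with
    | zero => simp [List.replicate_succ] at h
    | succ n =>
      simp only [List.replicate_succ, List.cons_append, List.cons.injEq, true_and] at h
      obtain ⟨h1, h2⟩ := ih h
      exact ⟨by rw [h1], h2⟩

theorem GraphBudget.encode_injective : Function.Injective GraphBudget.encode := by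
  rintro ⟨n, G, k⟩ ⟨m, H, l⟩ h
  obtain ⟨h1, h2⟩ := replicate_true_append_false_inj h
  dsimp only at h1 h2
  subst h1
  obtain ⟨h3, h4⟩ := List.append_inj h2 (by rw [adjacencyBits_length, adjacencyBits_length])
  have h5 : k = l := by
    have := congrArg Computability.decodeNat h4
    simpa using this
  rw [adjacencyBits_injective h3, h5]

/-- Vertex Cover parameterized by twin-cover: given `(G, k)`, is there a set of at most `k`
vertices containing at least one endpoint of every edge of `G`? The parameter is `tc(G)`. -/
noncomputable def vertexCoverByTwinCover : ParameterizedProblem where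
  Instance := GraphBudget
  encode := GraphBudget.encode
  encode_injective := GraphBudget.encode_injective
  IsYes x := ∃ S : Finset (Fin x.n), x.graph.IsVertexCover (S : Set (Fin x.n)) ∧
    S.card ≤ x.budget
  parameter x := x.graph.twinCoverNum

/-- Odd Cycle Transversal parameterized by twin-cover: given `(G, k)`, is there a set `S` of at
most `k` vertices such that `G - S` is bipartite? The parameter is `tc(G)`. -/
noncomputable def oddCycleTransversalByTwinCover : ParameterizedProblem where
  Instance := GraphBudget
  encode := GraphBudget.encode
  encode_injective := GraphBudget.encode_injective
  IsYes x := ∃ S : Finset (Fin x.n), x.graph.IsOddCycleTransversal (S : Set (Fin x.n)) ∧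
    S.card ≤ x.budget
  parameter x := x.graph.twinCoverNum

/-! Both problems ask for at most `k` deletions that leave a `c`-colourable graph, with `c = 1` for
Vertex Cover and `c = 2` for Odd Cycle Transversal; one construction serves both. Call adjacent
vertices with the same closed neighbourhood twins. A twin class is a clique, so at most `c` of its
members survive, and its members are interchangeable. Hence all but the first `c` members of each
class can be deleted, at one unit of budget each (`surplus_le_and_deletionColorable`).

A twin-cover is a vertex cover of the edges between non-twins. A minimum one is not computed.
Instead, as in Buss's rule, a threshold `t` on the non-twin degree defines a cover that has at most
`t * t + t` vertices whenever some cover has exactly `t`. The first threshold meeting this bound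
yields the core, whose size is therefore at most quadratic in the twin-cover number
(`coreSize_le_twinCoverNum`). After the truncation of classes, deleting the core leaves cliques with
at most `c` vertices, so the budget may be lowered to the size of the core.

For every pair of core vertices, possibly equal, and separately for classes with at least `c`
members (full) and smaller ones, the first `coreSize + 1` classes outside the core adjacent to both
are marked; unmarked classes outside the core are dropped. A solution is too small to meet all
marked classes of one kind. So a dropped full class has no surviving core neighbour: this neighbour
and an untouched marked class would form a clique on `c + 1` vertices. A smaller dropped class
occurs only for `c = 2` and is a single vertex; its surviving core neighbours all have the same
colour, as any two of them share a surviving marked neighbour. Either way the colouring extends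
(`deletionColorable_of_isKept`).

For the running time, the kernel is described by counting and bounded quantification. A small stack
language is compiled to `TM2`, and `PolyDef` collects the functions which it evaluates in unary in
polynomial time. This class is closed under recursion with polynomially bounded values
(`PolyDef.recursion`), and definable output bits give a machine (`PolyDef.tm2ComputableInPolyTime`).
The binary budget may be exponential, so it is read only up to twice the number of vertices. -/

open Function

/-! ### Stack machines with labels -/

/-- The contents of the stacks of a machine. -/
abbrev Stacks : Type := ℕ → List Bool

/-- The elementary instructions, with labels in `X`. -/
inductive StackInstr (X : Type) : Type
  | push (r : ℕ) (b : Bool) (next : X)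
  | pop (r : ℕ) (next : X)
  | test (r : ℕ) (next : Option Bool → X)

namespace StackInstr

variable {X Y : Type}

/-- Relabel the successors of an instruction. -/
def map (g : X → Y) : StackInstr X → StackInstr Y
  | push r b x => push r b (g x)
  | pop r x => pop r (g x)
  | test r f => test r fun o => g (f o)

/-- The successor label of an instruction. -/
def next : StackInstr X → Stacks → X
  | push _ _ x, _ => x
  | pop _ x, _ => x
  | test r f, s => f (s r).head?

/-- The effect of an instruction on the stacks. -/
def exec : StackInstr X → Stacks → Stacks
  | push r b _, s => update s r (b :: s r)
  | pop r _, s => update s r (s r).tail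
  | test _ _, s => s

/-- The stack used by an instruction. -/
def reg : StackInstr X → ℕ
  | push r _ _ => r
  | pop r _ => r
  | test r _ => r

theorem next_map (g : X → Y) (i : StackInstr X) (s : Stacks) :
    (i.map g).next s = g (i.next s) := by cases i <;> rfl

theorem exec_map (g : X → Y) (i : StackInstr X) (s : Stacks) :
    (i.map g).exec s = i.exec s := by cases i <;> rfl

end StackInstr

/-- `StackSteps code l s l' s' t`: from label `l` and stacks `s` the program `code` arrives at
label `l'` and stacks `s'` after at most `t` instructions; the label `none` is the exit. -/
inductive StackSteps {Λ : Type} (code : Λ → StackInstr (Option Λ)) :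
    Option Λ → Stacks → Option Λ → Stacks → ℕ → Prop
  | refl (l s t) : StackSteps code l s l s t
  | head {q s l' s' t} :
      StackSteps code ((code q).next s) ((code q).exec s) l' s' t →
        StackSteps code (some q) s l' s' (t + 1)

namespace StackSteps

variable {Λ Λ' : Type} {code : Λ → StackInstr (Option Λ)}

theorem trans {l₁ l₂ l₃ : Option Λ} {s₁ s₂ s₃ : Stacks} {t₁ t₂ : ℕ}
    (h₁ : StackSteps code l₁ s₁ l₂ s₂ t₁) (h₂ : StackSteps code l₂ s₂ l₃ s₃ t₂) :
    StackSteps code l₁ s₁ l₃ s₃ (t₁ + t₂) := by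
  have mono : ∀ {l l' : Option Λ} {s s' : Stacks} {t : ℕ} (u : ℕ),
      StackSteps code l s l' s' t → StackSteps code l s l' s' (u + t) := by
    intro l l' s s' t u h
    induction h with
    | refl => exact refl _ _ _
    | head _ ih => exact head ih
  induction h₁ with
  | refl l s t => exact mono t h₂
  | head _ ih =>
    rw [Nat.add_right_comm]
    exact head (ih h₂)

theorem mono {l l' : Option Λ} {s s' : Stacks} {t u : ℕ}
    (h : StackSteps code l s l' s' t) (hu : t ≤ u) : StackSteps code l s l' s' u := by
  obtain ⟨v, rfl⟩ := Nat.exists_eq_add_of_le hu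
  exact h.trans (refl _ _ _)

/-- A program embedded into a larger one. -/
theorem embed {code' : Λ' → StackInstr (Option Λ')} (e : Λ → Λ') (x : Option Λ')
    (he : ∀ q, code' (e q) = (code q).map fun o => o.elim x (some ∘ e))
    {l l' : Option Λ} {s s' : Stacks} {t : ℕ} (h : StackSteps code l s l' s' t) :
    StackSteps code' (l.elim x (some ∘ e)) s (l'.elim x (some ∘ e)) s' t := by
  induction h with
  | refl => exact refl _ _ _
  | head _ ih =>
    refine head ?_
    rw [he, StackInstr.next_map, StackInstr.exec_map]
    exact ih

end StackSteps

/-- `R s s' t` is realized by a machine: whenever it holds, the machine started with stacks `s`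
halts with stacks `s'` after at most `t` instructions. -/
def Realizable (R : Stacks → Stacks → ℕ → Prop) : Prop :=
  ∃ (Λ : Type) (_ : Fintype Λ) (code : Λ → StackInstr (Option Λ)) (entry : Option Λ),
    ∀ s s' t, R s s' t → StackSteps code entry s none s' t

namespace Realizable

variable {R R₁ R₂ : Stacks → Stacks → ℕ → Prop}

theorem mono (h : Realizable R₁) (H : ∀ s s' t, R₂ s s' t → R₁ s s' t) : Realizable R₂ := by
  obtain ⟨Λ, hΛ, code, entry, h⟩ := h
  exact ⟨Λ, hΛ, code, entry, fun s s' t hR => h s s' t (H s s' t hR)⟩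

theorem skip : Realizable fun s s' _ => s' = s :=
  ⟨Empty, inferInstance, fun q => q.elim, none, by rintro s _ t rfl; exact .refl _ _ _⟩

theorem push (r : ℕ) (b : Bool) :
    Realizable fun s s' t => s' = update s r (b :: s r) ∧ 1 ≤ t := by
  refine ⟨Unit, inferInstance, fun _ => .push r b none, some (), ?_⟩
  rintro s _ t ⟨rfl, ht⟩
  exact StackSteps.mono (.head (.refl _ _ 0)) ht

theorem pop (r : ℕ) :
    Realizable fun s s' t => s' = update s r (s r).tail ∧ 1 ≤ t := by
  refine ⟨Unit, inferInstance, fun _ => .pop r none, some (), ?_⟩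
  rintro s _ t ⟨rfl, ht⟩
  exact StackSteps.mono (.head (.refl _ _ 0)) ht

/-- The labels form a disjoint union, and the exit of the first program is redirected to the entry
of the second, which is itself the exit if the second program is empty. -/
theorem seq (h₁ : Realizable R₁) (h₂ : Realizable R₂) :
    Realizable fun s s' t => ∃ s₁ t₁ t₂, R₁ s s₁ t₁ ∧ R₂ s₁ s' t₂ ∧ t₁ + t₂ ≤ t := by
  obtain ⟨Λ₁, hΛ₁, code₁, entry₁, h₁⟩ := h₁
  obtain ⟨Λ₂, hΛ₂, code₂, entry₂, h₂⟩ := h₂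
  refine ⟨Λ₁ ⊕ Λ₂, inferInstance,
    Sum.elim
      (fun q => (code₁ q).map fun o =>
        o.elim (entry₂.elim none (some ∘ Sum.inr)) (some ∘ Sum.inl))
      (fun q => (code₂ q).map fun o => o.elim none (some ∘ Sum.inr)),
    entry₁.elim (entry₂.elim none (some ∘ Sum.inr)) (some ∘ Sum.inl), ?_⟩
  rintro s s' t ⟨s₁, t₁, t₂, hR₁, hR₂, ht⟩
  refine StackSteps.mono (StackSteps.trans (s₂ := s₁)
    (l₂ := entry₂.elim none (some ∘ Sum.inr)) ?_ ?_) ht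
  · exact (h₁ _ _ _ hR₁).embed Sum.inl _ fun _ => rfl
  · exact (h₂ _ _ _ hR₂).embed Sum.inr none fun _ => rfl

theorem ite (r : ℕ) (f : Option Bool → Bool) (h₁ : Realizable R₁) (h₂ : Realizable R₂) :
    Realizable fun s s' t => ∃ t', t' + 1 ≤ t ∧
      if f (s r).head? then R₁ s s' t' else R₂ s s' t' := by
  obtain ⟨Λ₁, hΛ₁, code₁, entry₁, h₁⟩ := h₁
  obtain ⟨Λ₂, hΛ₂, code₂, entry₂, h₂⟩ := h₂
  refine ⟨Option (Λ₁ ⊕ Λ₂), inferInstance, fun q => q.elim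
      (.test r fun o => if f o then entry₁.elim none (some ∘ some ∘ Sum.inl)
        else entry₂.elim none (some ∘ some ∘ Sum.inr))
      (Sum.elim
        (fun q => (code₁ q).map fun o => o.elim none (some ∘ some ∘ Sum.inl))
        (fun q => (code₂ q).map fun o => o.elim none (some ∘ some ∘ Sum.inr))),
    some none, ?_⟩
  rintro s s' t ⟨t', ht, h⟩
  refine StackSteps.mono (.head ?_) ht
  simp only [Option.elim_none, StackInstr.next, StackInstr.exec]
  split_ifs at h with hf
  · rw [if_pos hf]
    exact (h₁ _ _ _ h).embed (some ∘ Sum.inl) none fun _ => rfl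
  · rw [if_neg hf]
    exact (h₂ _ _ _ h).embed (some ∘ Sum.inr) none fun _ => rfl

/-- The run is an explicit trajectory `σ`, so each application supplies the state after `i` rounds
in closed form and termination needs no argument. One bound `τ` serves all rounds; every round adds
a test, and the failing test is the final `+ 1`. -/
theorem whileLoop (r : ℕ) (f : Option Bool → Bool) (h : Realizable R) :
    Realizable fun s s' t => ∃ (m τ : ℕ) (σ : ℕ → Stacks), σ 0 = s ∧ σ m = s' ∧
      (∀ i < m, f (σ i r).head? = true ∧ R (σ i) (σ (i + 1)) τ) ∧ f (σ m r).head? = false ∧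
      m * (τ + 1) + 1 ≤ t := by
  obtain ⟨Λ, hΛ, code, entry, h⟩ := h
  refine ⟨Option Λ, inferInstance, fun q => q.elim
      (.test r fun o => if f o then entry.elim (some none) (some ∘ some) else none)
      (fun q => (code q).map fun o => o.elim (some none) (some ∘ some)),
    some none, ?_⟩
  rintro s s' t ⟨m, τ, σ, rfl, rfl, hi, hm, ht⟩
  refine StackSteps.mono (StackSteps.trans (l₂ := some none) (s₂ := σ m) (t₁ := m * (τ + 1))
    ?_ ?_) ht
  · clear hm ht
    induction m with
    | zero => exact .refl _ _ _
    | succ m ih =>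
      rw [Nat.add_mul, Nat.one_mul]
      refine StackSteps.trans (ih fun i h => hi i (by omega)) (.head ?_)
      obtain ⟨h1, h2⟩ := hi m (by omega)
      simp only [Option.elim_none, StackInstr.next, StackInstr.exec, h1, if_true]
      exact (h _ _ _ h2).embed some (some none) fun _ => rfl
  · refine .head ?_
    simp only [Option.elim_none, StackInstr.next, StackInstr.exec, hm]
    exact .refl _ _ _

end Realizable

/-! ### Translation to `Turing.FinTM2` -/

section TM2

open Turing

variable {Λ : Type} (N : ℕ)

/-- The statement of a `TM2` machine which performs an instruction. -/
def StackInstr.toStmt (i : StackInstr (Option Λ)) :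
    TM2.Stmt (fun _ : Fin (N + 3) => Bool) (Option Λ) (Option Bool) :=
  match i with
  | .push r b x => .push (Fin.ofNat (N + 3) r) (fun _ => b) (.goto fun _ => x)
  | .pop r x => .pop (Fin.ofNat (N + 3) r) (fun v _ => v) (.goto fun _ => x)
  | .test r f => .peek (Fin.ofNat (N + 3) r) (fun _ o => o) (.goto fun v => f v)

/-- The `TM2` machine which runs a program, with input on stack `0` and output on stack `2`. -/
def stackFinTM2 [Fintype Λ] (code : Λ → StackInstr (Option Λ)) (entry : Option Λ) : FinTM2 where
  K := Fin (N + 3)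
  k₀ := 0
  k₁ := 2
  Γ _ := Bool
  Λ := Option Λ
  main := entry
  σ := Option Bool
  initialState := none
  -- The internal state is reset before halting, since the prescribed final configuration has the
  -- initial internal state.
  m q := q.elim (.load (fun _ => none) .halt) fun q => (code q).toStmt N

/-- Each instruction is exactly one `TM2` step. The bound on `reg` prevents `Fin.ofNat` from
identifying different stacks. -/
theorem StackSteps.evals [Fintype Λ] {code : Λ → StackInstr (Option Λ)} (entry : Option Λ)
    (hN : ∀ q, (code q).reg < N + 3) {l l' : Option Λ} {s s' : Stacks} {t : ℕ}
    (h : StackSteps code l s l' s' t) (v : Option Bool) :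
    ∃ n ≤ t, ∃ v', (flip bind (TM2.step (stackFinTM2 N code entry).m))^[n]
      (some (⟨some l, v, fun k => s k.val⟩ :
        TM2.Cfg (fun _ : Fin (N + 3) => Bool) (Option Λ) (Option Bool))) =
      some ⟨some l', v', fun k => s' k.val⟩ := by
  induction h generalizing v with
  | refl => exact ⟨0, Nat.zero_le _, v, rfl⟩
  | @head q s l' s' t _ ih =>
    have key : ∃ v₁, TM2.step (stackFinTM2 N code entry).m
        (⟨some (some q), v, fun k => s k.val⟩ :
          TM2.Cfg (fun _ : Fin (N + 3) => Bool) (Option Λ) (Option Bool)) =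
        some ⟨some ((code q).next s), v₁, fun k => (code q).exec s k.val⟩ := by
      have hreg := hN q
      have hu : ∀ (r : ℕ) (_ : r < N + 3) (x : List Bool),
          (update (fun k : Fin (N + 3) => s k.val) (Fin.ofNat (N + 3) r) x) =
            fun k => update s r x k.val := by
        intro r hr x
        funext k
        by_cases hk : k = Fin.ofNat (N + 3) r
        · subst hk
          simp [Nat.mod_eq_of_lt hr]
        · rw [update_of_ne hk, update_of_ne]
          rintro rfl
          exact hk (by ext; simp)
      simp only [TM2.step, stackFinTM2, Option.elim_some]
      have hr : ∀ r < N + 3, (Fin.ofNat (N + 3) r).val = r := fun r h => Nat.mod_eq_of_lt h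
      cases hc : code q with
      | push r b x =>
        rw [hc] at hreg
        refine ⟨v, congrArg some ?_⟩
        change (⟨some x, v, update (fun k => s k.val) (Fin.ofNat (N + 3) r)
          (b :: s (Fin.ofNat (N + 3) r).val)⟩ :
            TM2.Cfg (fun _ : Fin (N + 3) => Bool) (Option Λ) (Option Bool)) = _
        rw [hu r hreg, hr r hreg]
        rfl
      | pop r x =>
        rw [hc] at hreg
        refine ⟨v, congrArg some ?_⟩
        change (⟨some x, v, update (fun k => s k.val) (Fin.ofNat (N + 3) r)
          (s (Fin.ofNat (N + 3) r).val).tail⟩ :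
            TM2.Cfg (fun _ : Fin (N + 3) => Bool) (Option Λ) (Option Bool)) = _
        rw [hu r hreg, hr r hreg]
        rfl
      | test r f =>
        rw [hc] at hreg
        refine ⟨(s r).head?, congrArg some ?_⟩
        change (⟨some (f (s (Fin.ofNat (N + 3) r).val).head?),
          (s (Fin.ofNat (N + 3) r).val).head?, fun k => s k.val⟩ :
            TM2.Cfg (fun _ : Fin (N + 3) => Bool) (Option Λ) (Option Bool)) = _
        rw [hr r hreg]
        rfl
    obtain ⟨v₁, hv₁⟩ := key
    obtain ⟨n, hn, v', hv'⟩ := ih v₁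
    refine ⟨n + 1, by omega, v', ?_⟩
    rw [Function.iterate_succ_apply, ← hv']
    congr 1

theorem Realizable.tm2ComputableInPolyTime {α : Type} {enc : α → List Bool} {f : α → α}
    (p : Polynomial ℕ)
    (h : Realizable fun s s' t => ∃ a, s = update (fun _ => []) 0 (enc a) ∧
      s' = update (fun _ => []) 2 (enc (f a)) ∧ p.eval (enc a).length ≤ t) :
    Nonempty (TM2ComputableInPolyTime enc enc f) := by
  obtain ⟨Λ, hΛ, code, entry, h⟩ := h
  obtain ⟨N, hN⟩ : ∃ N, ∀ q, (code q).reg < N + 3 :=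
    ⟨∑ q, (code q).reg, fun q => by
      have := Finset.single_le_sum (f := fun q => (code q).reg) (fun _ _ => Nat.zero_le _)
        (Finset.mem_univ q)
      omega⟩
  have main : ∀ a, ∃ n ≤ p.eval (enc a).length, ∃ v',
      (flip bind (TM2.step (stackFinTM2 N code entry).m))^[n]
        (some (⟨some entry, none, fun k => update (fun _ => []) 0 (enc a) k.val⟩ :
          TM2.Cfg (fun _ : Fin (N + 3) => Bool) (Option Λ) (Option Bool))) =
        some ⟨some none, v', fun k => update (fun _ => []) 2 (enc (f a)) k.val⟩ :=
    fun a => (h _ _ _ ⟨a, rfl, rfl, le_rfl⟩).evals N entry hN none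
  choose n hn v' hv' using main
  -- The additional step executes the halting statement at the exit label.
  suffices H : ∀ a, (flip bind (stackFinTM2 N code entry).step)^[n a + 1]
      (some (initList (stackFinTM2 N code entry) (List.map (Equiv.refl Bool).invFun (enc a)))) =
      Option.map (haltList (stackFinTM2 N code entry))
        (some (List.map (Equiv.refl Bool).invFun (enc (f a)))) by
    exact ⟨{ tm := stackFinTM2 N code entry
             inputAlphabet := Equiv.refl Bool
             outputAlphabet := Equiv.refl Bool
             time := p + 1
             outputsFun := fun a => ⟨⟨n a + 1, H a⟩, by simpa using hn a⟩ }⟩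
  intro a
  rw [add_comm, Function.iterate_add_apply]
  have hmap : ∀ l : List Bool, List.map (Equiv.refl Bool).invFun l = l := List.map_id
  have h1 : initList (stackFinTM2 N code entry) (List.map (Equiv.refl Bool).invFun (enc a)) =
      (⟨some entry, none, fun k => update (fun _ => []) 0 (enc a) k.val⟩ :
          TM2.Cfg (fun _ : Fin (N + 3) => Bool) (Option Λ) (Option Bool)) := by
    refine congrArg (TM2.Cfg.mk (some entry) (none : Option Bool)) (funext fun k => ?_)
    by_cases hk : k = (0 : Fin (N + 3))
    · subst hk
      exact (dif_pos rfl).trans (hmap _)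
    · refine (dif_neg hk).trans (Eq.symm (dif_neg ?_))
      exact fun h => hk (Fin.ext h)
  have h2 : haltList (stackFinTM2 N code entry) (List.map (Equiv.refl Bool).invFun (enc (f a))) =
      (⟨none, none, fun k => update (fun _ => []) 2 (enc (f a)) k.val⟩ :
          TM2.Cfg (fun _ : Fin (N + 3) => Bool) (Option Λ) (Option Bool)) := by
    have hval : ((2 : Fin (N + 3)) : ℕ) = 2 := Fin.val_two
    refine congrArg (TM2.Cfg.mk none (none : Option Bool)) (funext fun k => ?_)
    by_cases hk : k = (2 : Fin (N + 3))
    · subst hk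
      refine (dif_pos rfl).trans ((hmap _).trans ?_)
      rw [hval, update_self]
    · refine (dif_neg hk).trans (Eq.symm (dif_neg ?_))
      exact fun h => hk (Fin.ext (h.trans hval.symm))
  simp only [Option.map_some]
  rw [h2]
  refine Eq.trans (congrArg _ ((congrArg _ (congrArg some h1)).trans (hv' a))) ?_
  rfl

end TM2

/-! ### Basic routines -/

/-- The number `n` in unary. -/
def unary (n : ℕ) : List Bool := List.replicate n true

@[simp] theorem unary_zero : unary 0 = [] := rfl

theorem unary_succ (n : ℕ) : unary (n + 1) = true :: unary n := rfl

@[simp] theorem length_unary (n : ℕ) : (unary n).length = n := List.length_replicate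

@[simp] theorem tail_unary (n : ℕ) : (unary n).tail = unary (n - 1) := by cases n <;> rfl

theorem unary_append (a b : ℕ) : unary a ++ unary b = unary (a + b) :=
  List.replicate_append_replicate

@[simp] theorem reverse_unary (n : ℕ) : (unary n).reverse = unary n := List.reverse_replicate

theorem isSome_head_unary (n : ℕ) : (unary n).head?.isSome = decide (n ≠ 0) := by
  cases n <;> simp [unary_succ]

namespace Realizable

variable {R R₁ R₂ : Stacks → Stacks → ℕ → Prop}

/-- Repeat a routine as long as the stack `r` is not empty, popping one symbol each time. -/
theorem forLoop (r : ℕ) (h : Realizable R) :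
    Realizable fun s s' t => ∃ (m τ : ℕ) (σ : ℕ → Stacks), σ 0 = s ∧ σ m = s' ∧
      (∀ i < m, (σ i r).length = m - i ∧ R (update (σ i) r (σ i r).tail) (σ (i + 1)) τ) ∧
      σ m r = [] ∧ m * (τ + 2) + 1 ≤ t := by
  refine (whileLoop r Option.isSome ((pop r).seq h)).mono ?_
  rintro s s' t ⟨m, τ, σ, h0, hm, hi, he, ht⟩
  refine ⟨m, τ + 1, σ, h0, hm, fun i him => ?_, by simp [he], ht⟩
  obtain ⟨h1, h2⟩ := hi i him
  refine ⟨?_, _, 1, τ, ⟨rfl, le_rfl⟩, h2, by omega⟩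
  cases hs : σ i r with
  | nil => rw [hs, List.length_nil] at h1; omega
  | cons => rfl

/-- Empty a stack. -/
theorem clear (r : ℕ) :
    Realizable fun s s' t => s' = update s r [] ∧ (s r).length * 2 + 1 ≤ t := by
  refine (forLoop r skip).mono ?_
  rintro s s' t ⟨rfl, ht⟩
  refine ⟨(s r).length, 0, fun i => update s r ((s r).drop i), by simp, by simp, ?_, by simp,
    by omega⟩
  intro i hi
  simp

/-- Move the top symbol of a stack to another one. -/
theorem moveTop {a b : ℕ} (hab : a ≠ b) :
    Realizable fun s s' t => s' = update (update s b ((s a).take 1 ++ s b)) a (s a).tail ∧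
      4 ≤ t := by
  -- Labels are the only memory, so each symbol has its own branch. An empty stack is left alone, on
  -- which reading beyond the end of a word relies.
  refine (ite a (fun o => o = some true) ((pop a).seq (push b true))
    (ite a (fun o => o = some false) ((pop a).seq (push b false)) skip)).mono ?_
  rintro s s' t ⟨rfl, ht⟩
  rcases hs : s a with _ | ⟨_ | _, l⟩
  · refine ⟨3, ht, ?_⟩
    have h : update s a [] = s := by rw [← hs, update_eq_self]
    simp only [List.head?_nil, reduceCtorEq, decide_false, Bool.false_eq_true, if_false]
    exact ⟨2, le_rfl, by simp [h]⟩
  · refine ⟨3, ht, ?_⟩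
    simp only [List.head?_cons, Option.some.injEq, Bool.false_eq_true, decide_false, if_false]
    refine ⟨2, le_rfl, ?_⟩
    simp only [decide_true, if_true]
    refine ⟨_, 1, 1, ⟨rfl, le_rfl⟩, ⟨?_, le_rfl⟩, le_rfl⟩
    rw [update_comm hab]
    simp [update_of_ne hab.symm]
  · refine ⟨3, ht, ?_⟩
    simp only [List.head?_cons, decide_true, if_true]
    refine ⟨_, 1, 1, ⟨rfl, le_rfl⟩, ⟨?_, le_rfl⟩, by omega⟩
    rw [update_comm hab]
    simp [update_of_ne hab.symm]

/-- Move a stack onto another one, reversing it. -/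
theorem moveAll {a b : ℕ} (hab : a ≠ b) :
    Realizable fun s s' t => s' = update (update s b ((s a).reverse ++ s b)) a [] ∧
      (s a).length * 5 + 1 ≤ t := by
  refine (whileLoop a Option.isSome (moveTop hab)).mono ?_
  rintro s s' t ⟨rfl, ht⟩
  refine ⟨(s a).length, 4,
    fun i => update (update s b (((s a).take i).reverse ++ s b)) a ((s a).drop i), by simp,
    by simp, ?_, by simp, by omega⟩
  intro i hi
  refine ⟨by simp [hi], ?_, le_rfl⟩
  have h1 := List.drop_eq_getElem_cons hi
  have h2 : (s a).take (i + 1) = (s a).take i ++ [(s a)[i]] := by simp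
  funext r
  by_cases ha : r = a
  · simp only [ha, update_self]
    rw [h1, List.tail_cons]
  by_cases hb : r = b
  · simp only [hb, update_self, ne_eq, hab.symm, not_false_eq_true, update_of_ne]
    rw [h1, h2, List.reverse_append]
    rfl
  · simp only [ne_eq, ha, hb, not_false_eq_true, update_of_ne]

/-- Append the length of a stack, in unary, to another stack. -/
theorem addLength {a b c : ℕ} (hab : a ≠ b) (hac : a ≠ c) (hbc : b ≠ c) :
    Realizable fun s s' t => s b = [] ∧ s' = update s c (unary (s a).length ++ s c) ∧
      (s a).length * 11 + 2 ≤ t := by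
  -- Stack `a` is emptied onto `b` and moved back with one mark on `c` per symbol; the two reversals
  -- restore it.
  refine ((moveAll hab).seq
    (whileLoop b Option.isSome ((moveTop hab.symm).seq (push c true)))).mono ?_
  rintro s s' t ⟨hb, rfl, ht⟩
  refine ⟨_, _, (s a).length * 6 + 1, ⟨rfl, le_rfl⟩, ⟨(s a).length, 5,
    fun i => update (update (update s c (unary i ++ s c)) b ((s a).reverse.drop i)) a
      ((s a).reverse.take i).reverse, ?_, ?_, ?_, ?_, le_rfl⟩, by omega⟩
  · funext r
    grind [update_apply, unary_zero]
  · have h1 : (s a).reverse.drop (s a).length = [] := by simp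
    have h2 : ((s a).reverse.take (s a).length).reverse = s a := by
      rw [List.take_of_length_le (by simp), List.reverse_reverse]
    funext r
    dsimp only
    rw [h1, h2]
    grind [update_apply]
  · intro i hi
    have hi' : i < (s a).reverse.length := by simpa using hi
    have h1 := List.drop_eq_getElem_cons hi'
    have h2 : (s a).reverse.take (i + 1) = (s a).reverse.take i ++ [(s a).reverse[i]] :=
      (List.take_append_getElem hi').symm
    refine ⟨?_, _, 4, 1, ⟨rfl, le_rfl⟩, ⟨?_, le_rfl⟩, le_rfl⟩
    · dsimp only
      rw [update_of_ne hab.symm, update_self, h1]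
      rfl
    · dsimp only
      rw [h2, h1, List.reverse_append]
      generalize ((s a).reverse.take i).reverse = u at *
      generalize (s a).reverse.drop (i + 1) = v at *
      funext r
      by_cases ha : r = a
      · subst ha
        simp [hab, hac, hab.symm]
      by_cases hb : r = b
      · subst hb
        simp [hab.symm, hbc]
      by_cases hc : r = c
      · subst hc
        simp [hac.symm, hbc.symm, unary_succ]
      · simp [ha, hb, hc]
  · simp [hab.symm]

end Realizable

/-- The bit of a word at a given position, or `0` beyond its end. -/
def bitAt (w : List Bool) (i : ℕ) : ℕ := if w[i]? = some true then 1 else 0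

/-! ### Polynomially definable number functions -/

theorem Polynomial.eval_nat_mono (p : Polynomial ℕ) : Monotone fun n => p.eval n := by
  intro m n h
  dsimp only
  induction p using Polynomial.induction_on' with
  | add p q hp hq => simpa using add_le_add hp hq
  | monomial k a => simpa using Nat.mul_le_mul_left a (Nat.pow_le_pow_left h k)

/-- A context: a word together with a fixed number of natural numbers. -/
class WordContext (C : Type) where
  /-- the word -/
  word : C → List Bool
  /-- the number of natural numbers -/
  arity : ℕ
  /-- the natural numbers -/
  var : C → Fin arity → ℕ

namespace WordContext

instance : WordContext (List Bool) where
  word w := w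
  arity := 0
  var _ := Fin.elim0

/-- The number added last has index `0`. -/
instance prodNat {C : Type} [WordContext C] : WordContext (C × ℕ) where
  word c := word c.1
  arity := arity C + 1
  var c := Fin.cons c.2 (var c.1)

variable {C D : Type} [WordContext C] [WordContext D]

/-- The size of a context. -/
def size (c : C) : ℕ := (word c).length + ∑ j, var c j

theorem size_prod (c : C) (i : ℕ) : size (c, i) = size c + i := by
  change (word c).length + ∑ j : Fin (arity C + 1), (Fin.cons i (var c) : Fin (arity C + 1) → ℕ) j
    = (word c).length + ∑ j, var c j + i
  rw [Fin.sum_univ_succ]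
  simp only [Fin.cons_zero, Fin.cons_succ]
  omega

/-- The stacks `s` hold the context `c` in the stacks `env`, and all stacks from `d` on are
empty. -/
structure Holds (env : Fin (arity C) → ℕ) (d : ℕ) (c : C) (s : Stacks) : Prop where
  word : s 0 = word c
  aux : s 1 = []
  var : ∀ j, s (env j) = unary (var c j)
  scratch : ∀ r, d ≤ r → s r = []

/-- The stacks used for a context, for the output and for intermediate results are different. -/
structure Separated (env : Fin (arity C) → ℕ) (out d : ℕ) : Prop where
  two_le : ∀ j, 2 ≤ env j
  lt : ∀ j, env j < d
  ne : ∀ j, env j ≠ out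
  two_le_out : 2 ≤ out
  out_lt : out < d

theorem Separated.scratch {env : Fin (arity C) → ℕ} {out d : ℕ}
    (h : Separated env out d) (i : ℕ) : Separated env (d + i) (d + i + 1) where
  two_le := h.two_le
  lt j := by have := h.lt j; omega
  ne j := by have := h.lt j; omega
  two_le_out := by have := h.two_le_out; have := h.out_lt; omega
  out_lt := by omega

theorem Separated.weaken {env : Fin (arity C) → ℕ} {out d : ℕ}
    (h : Separated env out d) (i : ℕ) : Separated env out (d + i) where
  two_le := h.two_le
  lt j := by have := h.lt j; omega
  ne := h.ne
  two_le_out := h.two_le_out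
  out_lt := by have := h.out_lt; omega

theorem Separated.cons {env : Fin (arity C) → ℕ} {out d i : ℕ}
    (h : Separated env out d) (hi : 2 ≤ i) (hd : i < d) (ho : i ≠ out) :
    Separated (C := C × ℕ) (Fin.cons i env) out d where
  two_le := Fin.cases hi h.two_le
  lt := Fin.cases hd h.lt
  ne := Fin.cases ho h.ne
  two_le_out := h.two_le_out
  out_lt := h.out_lt

theorem Holds.cons {env : Fin (arity C) → ℕ} {d i n : ℕ} {c : C} {s : Stacks}
    (h : Holds env d c s) (hi : s i = unary n) :
    Holds (C := C × ℕ) (Fin.cons i env) d (c, n) s where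
  word := h.word
  aux := h.aux
  var := Fin.cases hi h.var
  scratch := h.scratch

theorem Holds.weaken {env : Fin (arity C) → ℕ} {d d' : ℕ} {c : C} {s : Stacks}
    (h : Holds env d c s) (hd : d ≤ d') : Holds env d' c s where
  word := h.word
  aux := h.aux
  var := h.var
  scratch r hr := h.scratch r (hd.trans hr)

/-- The stacks of a context lie below `d` and differ from `out`, so writing to `out` or to scratch
stacks does not disturb it. -/
theorem Holds.congr {env : Fin (arity C) → ℕ} {out d d' : ℕ} {c : C} {s s' : Stacks}
    (hs : Separated env out d) (h : Holds env d c s)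
    (h' : ∀ r, r < d → r ≠ out → s' r = s r) (h'' : ∀ r, d' ≤ r → s' r = []) :
    Holds env d' c s' where
  word := by
    rw [h' 0, h.word] <;> have := hs.two_le_out <;> have := hs.out_lt <;> omega
  aux := by
    rw [h' 1, h.aux] <;> have := hs.two_le_out <;> have := hs.out_lt <;> omega
  var j := by rw [h' _ (hs.lt j) (hs.ne j), h.var]
  scratch := h''

/-- `f` can be evaluated by a machine, in unary, in polynomial time. -/
def PolyDef (f : C → ℕ) : Prop :=
  -- Values are stored in unary, so the cost of using a value depends on its size.
  (∃ q : Polynomial ℕ, ∀ c, f c ≤ q.eval (size c)) ∧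
  ∀ (env : Fin (arity C) → ℕ) (out d : ℕ), Separated env out d →
    ∃ p : Polynomial ℕ, Realizable fun s s' t => ∃ c, Holds env d c s ∧
      -- The value is put on top of the contents of `out`, so that addition is mere sequencing.
      s' = update s out (unary (f c) ++ s out) ∧ p.eval (size c) ≤ t

namespace PolyDef

theorem congr {f g : C → ℕ} (hf : PolyDef f) (h : ∀ c, f c = g c) : PolyDef g := by
  rwa [← funext h]

theorem const (n : ℕ) : PolyDef fun _ : C => n := by
  refine ⟨⟨Polynomial.C n, fun c => by simp⟩, fun env out d _ => ?_⟩
  refine ⟨Polynomial.C n, ?_⟩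
  induction n with
  | zero =>
    refine Realizable.skip.mono ?_
    rintro s _ t ⟨c, -, rfl, -⟩
    simp
  | succ n ih =>
    refine (Realizable.seq (R₁ := fun s s' t => s' = update s out (unary n ++ s out) ∧ n ≤ t)
      ?_ (Realizable.push out true)).mono ?_
    · clear ih
      induction n with
      | zero => exact Realizable.skip.mono (by rintro s _ t ⟨rfl, -⟩; simp)
      | succ n ih =>
        refine (ih.seq (Realizable.push out true)).mono ?_
        rintro s _ t ⟨rfl, ht⟩
        exact ⟨_, n, 1, ⟨rfl, le_rfl⟩, ⟨by simp [unary_succ], le_rfl⟩, ht⟩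
    · rintro s _ t ⟨c, -, rfl, ht⟩
      exact ⟨_, n, 1, ⟨rfl, le_rfl⟩, ⟨by simp [unary_succ], le_rfl⟩, by simpa using ht⟩

theorem var_le_size (c : C) (j : Fin (arity C)) : WordContext.var c j ≤ size c := by
  have := Finset.single_le_sum (f := WordContext.var c) (fun _ _ => Nat.zero_le _)
    (Finset.mem_univ j)
  rw [size]
  omega

theorem var (j : Fin (arity C)) : PolyDef fun c : C => var c j := by
  refine ⟨⟨Polynomial.X, fun c => by simpa using var_le_size c j⟩, fun env out d hs => ?_⟩
  have h1 := hs.lt j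
  have h2 := hs.out_lt
  refine ⟨11 * Polynomial.X + 2, (Realizable.addLength (a := env j) (b := d) (c := out)
    h1.ne (hs.ne j) h2.ne').mono ?_⟩
  rintro s _ t ⟨c, hc, rfl, ht⟩
  rw [hc.var, length_unary]
  refine ⟨hc.scratch d le_rfl, rfl, le_trans ?_ ht⟩
  have := var_le_size c j
  simp
  omega

theorem wordLength : PolyDef fun c : C => (word c).length := by
  refine ⟨⟨Polynomial.X, fun c => by simp [size]⟩, fun env out d hs => ?_⟩
  have h1 := hs.two_le_out
  refine ⟨11 * Polynomial.X + 2, (Realizable.addLength (a := 0) (b := 1) (c := out)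
    (by omega) (by omega) (by omega)).mono ?_⟩
  rintro s _ t ⟨c, hc, rfl, ht⟩
  rw [hc.word]
  refine ⟨hc.aux, rfl, le_trans ?_ ht⟩
  simp [size]
  omega

theorem of_var {f : C → ℕ} (j : Fin (arity C)) (h : ∀ c, WordContext.var c j = f c) :
    PolyDef f := (var j).congr h

/-- Rename the variables of a context. -/
theorem rename {f : D → ℕ} (hf : PolyDef f) (ρ : C → D) (σ : Fin (arity D) → Fin (arity C))
    (hw : ∀ c, word (ρ c) = word c) (hv : ∀ c j, WordContext.var (ρ c) j =
      WordContext.var c (σ j)) : PolyDef fun c => f (ρ c) := by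
  obtain ⟨⟨qf, hqf⟩, hf⟩ := hf
  -- Several variables of `D` may come from the same variable of `C`, hence the factor.
  have hsize : ∀ c, size (ρ c) ≤ (1 + arity D) * size c := by
    intro c
    have h1 : (word c).length ≤ size c := Nat.le_add_right _ _
    have h2 : ∑ j, WordContext.var (ρ c) j ≤ arity D * size c := by
      have := Finset.sum_le_card_nsmul Finset.univ (WordContext.var (ρ c)) (size c)
        fun j _ => by rw [hv]; exact var_le_size c _
      simpa using this
    rw [size, hw, Nat.add_mul, Nat.one_mul]
    exact Nat.add_le_add h1 h2
  refine ⟨⟨qf.comp (Polynomial.C (1 + arity D) * Polynomial.X), fun c => (hqf _).trans ?_⟩,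
    fun env out d hs => ?_⟩
  · rw [Polynomial.eval_comp]
    exact qf.eval_nat_mono (by simpa using hsize c)
  obtain ⟨pf, hf⟩ := hf (env ∘ σ) out d
    ⟨fun j => hs.two_le _, fun j => hs.lt _, fun j => hs.ne _, hs.two_le_out, hs.out_lt⟩
  refine ⟨pf.comp (Polynomial.C (1 + arity D) * Polynomial.X), hf.mono ?_⟩
  rintro s _ t ⟨c, hc, rfl, ht⟩
  refine ⟨ρ c, ⟨by rw [hw, hc.word], hc.aux, fun j => by rw [hv]; exact hc.var _, hc.scratch⟩,
    rfl, le_trans ?_ ht⟩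
  rw [Polynomial.eval_comp]
  exact pf.eval_nat_mono (by simpa using hsize c)

theorem add {f g : C → ℕ} (hf : PolyDef f) (hg : PolyDef g) : PolyDef fun c => f c + g c := by
  obtain ⟨⟨qf, hqf⟩, hf⟩ := hf
  obtain ⟨⟨qg, hqg⟩, hg⟩ := hg
  refine ⟨⟨qf + qg, fun c => by simpa using add_le_add (hqf c) (hqg c)⟩, fun env out d hs => ?_⟩
  obtain ⟨pf, hf⟩ := hf env out d hs
  obtain ⟨pg, hg⟩ := hg env out d hs
  refine ⟨pg + pf, (hg.seq hf).mono ?_⟩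
  rintro s _ t ⟨c, hc, rfl, ht⟩
  refine ⟨_, _, _, ⟨c, hc, rfl, le_rfl⟩, ⟨c, ?_, ?_, le_rfl⟩, by simpa using ht⟩
  · refine hc.congr hs (fun r _ hr => update_of_ne hr _ _) fun r hr => ?_
    rw [update_of_ne (by have := hs.out_lt; omega), hc.scratch r hr]
  · simp [← unary_append]

/-- The value of `g` is left on the scratch stack `d`, which plays the new variable while `f` is
evaluated and is emptied afterwards. -/
theorem bind {f : C × ℕ → ℕ} {g : C → ℕ} (hf : PolyDef f) (hg : PolyDef g) :
    PolyDef fun c => f (c, g c) := by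
  obtain ⟨⟨qf, hqf⟩, hf⟩ := hf
  obtain ⟨⟨qg, hqg⟩, hg⟩ := hg
  refine ⟨⟨qf.comp (Polynomial.X + qg), fun c => (hqf _).trans ?_⟩, fun env out d hs => ?_⟩
  · rw [size_prod, Polynomial.eval_comp]
    exact qf.eval_nat_mono (by simpa using hqg c)
  obtain ⟨pg, hg⟩ := hg env d (d + 1) (hs.scratch 0)
  obtain ⟨pf, hf⟩ := hf (Fin.cons d env) out (d + 1) ((hs.weaken 1).cons
    (by have := hs.two_le_out; have := hs.out_lt; omega) (by omega) hs.out_lt.ne')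
  refine ⟨pg + pf.comp (Polynomial.X + qg) + 2 * qg + 1,
    (hg.seq (hf.seq (Realizable.clear d))).mono ?_⟩
  rintro s _ t ⟨c, hc, rfl, ht⟩
  have hd : s d = [] := hc.scratch d le_rfl
  have hod := hs.out_lt
  have h1 : Holds env (d + 1) c (update s d (unary (g c))) :=
    hc.congr hs (fun r h1 h2 => update_of_ne (by omega) _ _) fun r hr => by
      rw [update_of_ne (by omega), hc.scratch r (by omega)]
  refine ⟨_, _, _, ⟨c, hc.weaken (by omega), rfl, le_rfl⟩,
    ⟨_, _, _, ⟨(c, g c), ?_, rfl, le_rfl⟩, ⟨?_, le_rfl⟩, le_rfl⟩, ?_⟩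
  · rw [hd, List.append_nil]
    exact h1.cons (by simp)
  · funext r
    grind [update_apply]
  · refine le_trans ?_ ht
    have := hqg c
    have := pf.eval_nat_mono (Nat.add_le_add_left (hqg c) (size c))
    simp only [hod.ne', ne_eq, not_false_eq_true, update_of_ne, update_self, hd, List.append_nil,
      length_unary, size_prod, Polynomial.eval_add, Polynomial.eval_comp, Polynomial.eval_X,
      Polynomial.eval_mul, Polynomial.eval_ofNat, Polynomial.eval_one] at *
    omega

theorem cond {f g h : C → ℕ} (hf : PolyDef f) (hg : PolyDef g) (hh : PolyDef h) :
    PolyDef fun c => if f c ≠ 0 then g c else h c := by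
  obtain ⟨⟨qf, hqf⟩, hf⟩ := hf
  obtain ⟨⟨qg, hqg⟩, hg⟩ := hg
  obtain ⟨⟨qh, hqh⟩, hh⟩ := hh
  refine ⟨⟨qg + qh, fun c => ?_⟩, fun env out d hs => ?_⟩
  · have := hqg c
    have := hqh c
    rw [Polynomial.eval_add]
    dsimp only
    split_ifs <;> omega
  obtain ⟨pf, hf⟩ := hf env d (d + 1) (hs.scratch 0)
  obtain ⟨pg, hg⟩ := hg env out d hs
  obtain ⟨ph, hh⟩ := hh env out d hs
  refine ⟨pf + (pg + ph + 2 * qf + 2),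
    (hf.seq (Realizable.ite d Option.isSome ((Realizable.clear d).seq hg) hh)).mono ?_⟩
  rintro s _ t ⟨c, hc, rfl, ht⟩
  have hd : s d = [] := hc.scratch d le_rfl
  have hupd : update s d [] = s := by rw [← hd, update_eq_self]
  refine ⟨_, _, _, ⟨c, hc.weaken (by omega), rfl, le_rfl⟩, ⟨pg.eval (size c) + ph.eval (size c) +
    2 * qf.eval (size c) + 1, le_rfl, ?_⟩, le_trans (by simp) ht⟩
  rw [update_self, hd, List.append_nil, isSome_head_unary]
  dsimp only
  by_cases h1 : f c = 0
  · rw [h1, unary_zero, hupd, if_neg (by simp), if_neg (by simp)]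
    exact ⟨c, hc, rfl, by omega⟩
  · rw [if_pos (by simpa using h1), if_pos h1]
    refine ⟨_, _, _, ⟨rfl, le_rfl⟩, ⟨c, ?_, ?_, le_rfl⟩, ?_⟩
    · rwa [update_idem, hupd]
    · rw [update_idem, hupd]
    · have := hqf c
      rw [length_unary]
      omega

/-- One symbol of the first value is popped for each symbol of the second. Popping an empty stack
does nothing, which gives truncated subtraction. -/
theorem sub {f g : C → ℕ} (hf : PolyDef f) (hg : PolyDef g) : PolyDef fun c => f c - g c := by
  obtain ⟨⟨qf, hqf⟩, hf⟩ := hf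
  obtain ⟨⟨qg, hqg⟩, hg⟩ := hg
  refine ⟨⟨qf, fun c => (Nat.sub_le _ _).trans (hqf c)⟩, fun env out d hs => ?_⟩
  obtain ⟨pf, hf⟩ := hf env d (d + 1) (hs.scratch 0)
  obtain ⟨pg, hg⟩ := hg env (d + 1) (d + 2) (hs.scratch 1)
  refine ⟨pf + (pg + (3 * qg + (5 * qf + 2))),
    (hf.seq (hg.seq ((Realizable.forLoop (d + 1) (Realizable.pop d)).seq
      (Realizable.moveAll (a := d) (b := out) hs.out_lt.ne')))).mono ?_⟩
  rintro s _ t ⟨c, hc, rfl, ht⟩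
  have hd : s d = [] := hc.scratch d le_rfl
  have hd1 : s (d + 1) = [] := hc.scratch (d + 1) (by omega)
  have hod := hs.out_lt
  have h1 : Holds env (d + 2) c (update s d (unary (f c))) :=
    hc.congr hs (fun r h1 h2 => update_of_ne (by omega) _ _) fun r hr => by
      rw [update_of_ne (by omega), hc.scratch r (by omega)]
  refine ⟨_, _, _, ⟨c, hc.weaken (by omega), rfl, le_rfl⟩, ⟨_, _, _, ⟨c, ?_, rfl, le_rfl⟩,
    ⟨update s d (unary (f c - g c)), g c * 3 + 1, _, ⟨g c, 1, fun i =>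
      update (update s d (unary (f c - i))) (d + 1) (unary (g c - i)), ?_, ?_, ?_, ?_, le_rfl⟩,
      ⟨?_, le_rfl⟩, le_rfl⟩, le_rfl⟩, le_trans ?_ ht⟩
  · rwa [hd, List.append_nil]
  · simp [hd, hd1]
  · funext r
    grind [update_apply, unary_zero]
  · intro i hi
    refine ⟨by simp, ?_, le_rfl⟩
    funext r
    by_cases hr : r = d
    · subst hr
      simp [Nat.sub_sub]
    by_cases hr1 : r = d + 1
    · subst hr1
      simp [Nat.sub_sub]
    · simp [hr, hr1]
  · simp
  · funext r
    by_cases ho : r = out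
    · subst ho
      simp [hod.ne]
    by_cases hr : r = d
    · subst hr
      simp [ho, hd]
    · simp [ho, hr]
  · have := hqf c
    have := hqg c
    simp
    omega

/-- The first `f c` symbols of the word are moved to the auxiliary stack `1`, the new top is
inspected, and the symbols are moved back. -/
theorem bit {f : C → ℕ} (hf : PolyDef f) : PolyDef fun c => bitAt (word c) (f c) := by
  obtain ⟨⟨qf, hqf⟩, hf⟩ := hf
  refine ⟨⟨1, fun c => ?_⟩, fun env out d hs => ?_⟩
  · simp only [bitAt, Polynomial.eval_one]
    split_ifs <;> omega
  obtain ⟨pf, hf⟩ := hf env d (d + 1) (hs.scratch 0)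
  refine ⟨pf + (6 * qf + 1 + (3 + (5 * qf + 1))), (hf.seq ((Realizable.forLoop d
    (Realizable.moveTop (a := 0) (b := 1) (by omega))).seq
    ((Realizable.ite 0 (fun o => o = some true) (Realizable.push out true) Realizable.skip).seq
    (Realizable.moveAll (a := 1) (b := 0) (by omega))))).mono ?_⟩
  rintro s _ t ⟨c, hc, rfl, ht⟩
  have hd : s d = [] := hc.scratch d le_rfl
  have hod := hs.out_lt
  have ho2 := hs.two_le_out
  have h0 := hc.word
  have h1 := hc.aux
  dsimp only
  generalize word c = w at *
  have hh : (w.drop (f c)).head? = w[f c]? := List.head?_drop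
  have hlen := List.length_take_le (f c) w
  have happ : w.take (f c) ++ w.drop (f c) = w := List.take_append_drop _ _
  have key : ∀ i, w.take (i + 1) = w.take i ++ (w.drop i).take 1 := fun i => List.take_add
  have hdrop : ∀ i, (w.drop i).tail = w.drop (i + 1) := fun i => List.tail_drop
  have hrev : ∀ l : List Bool, (l.take 1).reverse = l.take 1 := by
    rintro (_ | ⟨_, _⟩) <;> rfl
  refine ⟨_, _, _, ⟨c, hc.weaken (by omega), rfl, le_rfl⟩,
    ⟨_, _, _, ⟨f c, 4, fun i => update (update (update s d (unary (f c - i))) 0 (w.drop i)) 1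
      (w.take i).reverse, ?_, rfl, ?_, ?_, le_rfl⟩,
    ⟨update (update (update s out (unary (bitAt w (f c)) ++ s out)) 0 (w.drop (f c))) 1
      (w.take (f c)).reverse, 3, _,
      ⟨2, le_rfl, ?_⟩, ⟨?_, le_rfl⟩, le_rfl⟩, le_rfl⟩, le_trans ?_ ht⟩
  · funext r
    by_cases hr : r = d
    · subst hr
      have : r ≠ 0 := by omega
      have : r ≠ 1 := by omega
      simp [*]
    by_cases hr0 : r = 0
    · subst hr0
      simp [*]
    by_cases hr1 : r = 1
    · subst hr1
      simp [*]
    · simp [*]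
  · intro i hi
    have hd0 : d ≠ 0 := by omega
    have hd1 : d ≠ 1 := by omega
    refine ⟨by simp [hd0, hd1], ?_, le_rfl⟩
    funext r
    by_cases hr : r = d
    · subst hr
      simp [hd0, hd1, Nat.sub_sub]
    by_cases hr0 : r = 0
    · subst hr0
      simp [hd0.symm]
    by_cases hr1 : r = 1
    · subst hr1
      simp only [ne_eq, hd1.symm, zero_ne_one, one_ne_zero, not_false_eq_true, update_self,
        update_of_ne, hd0.symm]
      rw [key, List.reverse_append, hrev]
    · simp [hr, hr0, hr1]
  · have hd0 : d ≠ 0 := by omega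
    have hd1 : d ≠ 1 := by omega
    simp [hd0, hd1]
  · have hd0 : d ≠ 0 := by omega
    have hd1 : d ≠ 1 := by omega
    have hupd : update s d [] = s := by rw [← hd, update_eq_self]
    have ho0 : out ≠ 0 := by omega
    have ho1 : out ≠ 1 := by omega
    simp only [Nat.sub_self, unary_zero, hupd, ne_eq, zero_ne_one, not_false_eq_true, update_of_ne,
      update_self, hh, decide_eq_true_eq, bitAt]
    split_ifs with hb
    · refine ⟨?_, by omega⟩
      rw [update_comm ho0, update_comm ho1]
      simp [ho0, ho1, unary_succ]
    · simp
  · funext r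
    by_cases hr0 : r = 0
    · subst hr0
      have : (0 : ℕ) ≠ out := by omega
      simp [*]
    by_cases hr1 : r = 1
    · subst hr1
      have : (1 : ℕ) ≠ out := by omega
      simp [*]
    · simp [*]
  · have := hqf c
    simp only [update_self, List.length_reverse, Polynomial.eval_add, Polynomial.eval_mul,
      Polynomial.eval_ofNat, Polynomial.eval_one]
    omega

/-- The values of a primitive recursion. -/
def recVal (init : C → ℕ) (step : (C × ℕ) × ℕ → ℕ) (c : C) : ℕ → ℕ
  | 0 => init c
  | i + 1 => step ((c, recVal init step c i), i)

/-- The bound `hb` on intermediate values is essential, as iterating a polynomially bounded step may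
produce exponential values. Stack `d` counts the remaining rounds, `d + 1` holds the current value,
`d + 2` the index of the round, and `d + 3` receives the new value. -/
theorem recursion {init count : C → ℕ} {step : (C × ℕ) × ℕ → ℕ} (hi : PolyDef init)
    (hs : PolyDef step) (hn : PolyDef count)
    (hb : ∃ q : Polynomial ℕ, ∀ c, ∀ i ≤ count c, recVal init step c i ≤ q.eval (size c)) :
    PolyDef fun c => recVal init step c (count c) := by
  obtain ⟨q, hq⟩ := hb
  obtain ⟨-, hi⟩ := hi
  obtain ⟨-, hst⟩ := hs
  obtain ⟨⟨qn, hqn⟩, hn⟩ := hn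
  refine ⟨⟨q, fun c => hq c _ le_rfl⟩, fun env out d hs => ?_⟩
  have hod := hs.out_lt
  have ho2 := hs.two_le_out
  obtain ⟨pn, hn⟩ := hn env d (d + 1) (hs.scratch 0)
  obtain ⟨pi, hi⟩ := hi env (d + 1) (d + 2) (hs.scratch 1)
  obtain ⟨ps, hst⟩ := hst (Fin.cons (d + 2) (Fin.cons (d + 1) env)) (d + 3) (d + 4)
    (((hs.scratch 3).cons (i := d + 1) (by omega) (by omega) (by omega)).cons
      (by omega) (by omega) (by omega))
  refine ⟨pn + (pi + (qn * (ps.comp (Polynomial.X + q + qn) + 7 * q + 5) + 1 +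
    (2 * qn + 1 + (5 * q + 1)))), (hn.seq (hi.seq ((Realizable.forLoop d
      (hst.seq ((Realizable.clear (d + 1)).seq
        ((Realizable.moveAll (a := d + 3) (b := d + 1) (by omega)).seq
          (Realizable.push (d + 2) true))))).seq
      ((Realizable.clear (d + 2)).seq
        (Realizable.moveAll (a := d + 1) (b := out) (by omega)))))).mono ?_⟩
  rintro s _ t ⟨c, hc, rfl, ht⟩
  have hd : s d = [] := hc.scratch d le_rfl
  have hd1 : s (d + 1) = [] := hc.scratch _ (by omega)
  have hd2 : s (d + 2) = [] := hc.scratch _ (by omega)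
  have hd3 : s (d + 3) = [] := hc.scratch _ (by omega)
  have hholds : ∀ s' : Stacks, (∀ r, r < d → s' r = s r) → ∀ d', (∀ r, d' ≤ r → s' r = []) →
      Holds env d' c s' := fun s' h d' h' => hc.congr hs (fun r h1 _ => h r h1) h'
  refine ⟨_, _, _, ⟨c, hc.weaken (by omega), rfl, le_rfl⟩, ⟨_, _, _, ⟨c, ?_, rfl, le_rfl⟩,
    ⟨_, _, _, ⟨count c, ps.eval (size c + q.eval (size c) + qn.eval (size c)) +
        7 * q.eval (size c) + 3, fun i =>
      update (update (update s d (unary (count c - i))) (d + 1) (unary (recVal init step c i)))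
        (d + 2) (unary i), ?_, rfl, ?_, ?_, le_rfl⟩,
      ⟨_, _, _, ⟨rfl, le_rfl⟩, ⟨?_, le_rfl⟩, le_rfl⟩, le_rfl⟩, le_rfl⟩, le_trans ?_ ht⟩
  · refine hholds _ (fun r hr => update_of_ne (by omega) _ _) _ fun r hr => ?_
    rw [update_of_ne (by omega), hc.scratch r (by omega)]
  · funext r
    by_cases hr2 : r = d + 2
    · subst hr2
      simp [hd2]
    · simp [hd, hd1, hr2, recVal]
  · intro i him
    have hn1 : d ≠ d + 1 := by omega
    have hn2 : d ≠ d + 2 := by omega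
    refine ⟨by simp, ?_⟩
    refine ⟨_, ps.eval (size c + q.eval (size c) + qn.eval (size c)), 7 * q.eval (size c) + 3,
      ⟨((c, recVal init step c i), i), ?_, rfl, ?_⟩,
      ⟨_, 2 * q.eval (size c) + 1, 5 * q.eval (size c) + 2, ⟨rfl, ?_⟩,
        ⟨_, 5 * q.eval (size c) + 1, 1, ⟨rfl, ?_⟩, ⟨?_, le_rfl⟩, le_rfl⟩, by omega⟩, by omega⟩
    · refine Holds.cons (Holds.cons (hholds _ (fun r hr => ?_) _ fun r hr => ?_) ?_) ?_
      · have h0 : r ≠ d := by omega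
        have h1 : r ≠ d + 1 := by omega
        have h2 : r ≠ d + 2 := by omega
        simp [h0, h1, h2]
      · have h0 : r ≠ d := by omega
        have h1 : r ≠ d + 1 := by omega
        have h2 : r ≠ d + 2 := by omega
        simp [h0, h1, h2, hc.scratch r (by omega)]
      · simp
      · simp
    · rw [size_prod, size_prod]
      refine ps.eval_nat_mono ?_
      have := hq c i him.le
      have := hqn c
      omega
    · have := hq c i him.le
      simp
      omega
    · have := hq c (i + 1) him
      rw [recVal] at this
      simp [hd3]
      omega
    · funext r
      by_cases hr : r = d
      · subst hr
        simp [Nat.sub_sub]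
      by_cases hr1 : r = d + 1
      · subst hr1
        simp [hd3, recVal]
      by_cases hr2 : r = d + 2
      · subst hr2
        simp [unary_succ]
      by_cases hr3 : r = d + 3
      · subst hr3
        simp [hd3]
      · simp [hr, hr1, hr2, hr3]
  · simp
  · funext r
    by_cases hr : r = d
    · subst hr
      simp [hd, hod.ne']
    by_cases hr1 : r = d + 1
    · subst hr1
      have : d + 1 ≠ out := by omega
      simp [hd1, this]
    by_cases hr2 : r = d + 2
    · subst hr2
      have : d + 2 ≠ out := by omega
      simp [hd2, this]
    by_cases ho : r = out
    · subst ho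
      simp [hr, hr1, hr2]
    · simp [hr, hr1, hr2, ho]
  · have h1 := hqn c
    have h2 := hq c _ le_rfl
    simp [hd1] at *
    have h3 : count c *
        (ps.eval (size c + q.eval (size c) + qn.eval (size c)) + 7 * q.eval (size c) + 3 + 2) ≤ _ *
        (ps.eval (size c + q.eval (size c) + qn.eval (size c)) + 7 * q.eval (size c) + 5) :=
      Nat.mul_le_mul_right _ h1
    omega

end PolyDef

/-- A function on instances whose encodings have definable lengths and bits is computable in
polynomial time. -/
theorem PolyDef.tm2ComputableInPolyTime {α : Type} {enc : α → List Bool} {f : α → α}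
    {L : List Bool → ℕ} {B : List Bool × ℕ → ℕ} (hL : PolyDef L) (hB : PolyDef B)
    (h : ∀ a, enc (f a) = (List.range (L (enc a))).map fun i => decide (B (enc a, i) ≠ 0)) :
    Nonempty (Turing.TM2ComputableInPolyTime enc enc f) := by
  obtain ⟨⟨qL, hqL⟩, hL⟩ := hL
  obtain ⟨⟨qB, hqB⟩, hB⟩ := hB
  have hs : Separated (C := List Bool) Fin.elim0 3 4 :=
    ⟨fun j => j.elim0, fun j => j.elim0, fun j => j.elim0, by omega, by omega⟩
  obtain ⟨pL, hL⟩ := hL Fin.elim0 3 4 hs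
  obtain ⟨pB, hB⟩ := hB (Fin.cons 3 Fin.elim0) 4 5
    ((hs.scratch 0).cons (by omega) (by omega) (by omega))
  -- Pushing reverses the order, so the bits are produced from the last to the first: after its pop,
  -- the loop counter on stack `3` is the position of the next bit. The input is erased at the end
  -- because only the output stack may be non-empty.
  refine Realizable.tm2ComputableInPolyTime (pL + (qL * (pB.comp (Polynomial.X + qL) +
    2 * qB.comp (Polynomial.X + qL) + 5) + 1 + (2 * Polynomial.X + 1)))
    ((hL.seq ((Realizable.forLoop 3 (hB.seq (Realizable.ite 4 Option.isSome
      ((Realizable.clear 4).seq (Realizable.push 2 true)) (Realizable.push 2 false)))).seq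
      (Realizable.clear 0))).mono ?_)
  rintro _ _ t ⟨a, rfl, rfl, ht⟩
  rw [h]
  generalize hw : enc a = w at *
  have hsize : size w = w.length :=
    Nat.add_eq_left.2 (Finset.sum_eq_zero fun j _ => Fin.elim0 j)
  set b : ℕ → Bool := fun i => decide (B (w, i) ≠ 0) with hbdef
  set P := pB.eval (w.length + qL.eval w.length) with hP
  set Q := qB.eval (w.length + qL.eval w.length) with hQ
  refine ⟨_, _, _, ⟨w, ⟨rfl, rfl, fun j => j.elim0, fun r hr => update_of_ne (by omega) _ _⟩,
    rfl, le_rfl⟩, ⟨_, _, _, ⟨L w, P + (2 * Q + 3), fun i =>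
      update (update (update (fun _ => []) 0 w) 3 (unary (L w - i))) 2
        (((List.range (L w)).map b).drop (L w - i)), ?_, rfl, ?_, ?_, le_rfl⟩,
      ⟨?_, le_rfl⟩, le_rfl⟩, le_trans ?_ ht⟩
  · funext r
    by_cases hr : r = 2
    · subst hr
      simp [List.drop_eq_nil_of_le]
    · simp [hr]
  · intro i hi
    have hj : L w - (i + 1) < L w := by omega
    have hjL := (show L w - (i + 1) ≤ L w from hj.le).trans (hqL w)
    refine ⟨by simp, ?_⟩
    refine ⟨_, P, 2 * Q + 3, ⟨(w, L w - (i + 1)), ⟨rfl, rfl, Fin.cases ?_ fun j => j.elim0,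
      fun r hr => ?_⟩, rfl, ?_⟩, ⟨2 * Q + 2, le_rfl, ?_⟩, le_rfl⟩
    · have : r ≠ 0 := by omega
      have : r ≠ 2 := by omega
      have : r ≠ 3 := by omega
      simp [*]
    · rw [size_prod, hsize]
      exact pB.eval_nat_mono (by rw [hsize] at hjL; omega)
    · simp [Nat.sub_sub]
      rfl
    · have hdrop : ((List.range (L w)).map b).drop (L w - (i + 1)) =
          b (L w - (i + 1)) :: ((List.range (L w)).map b).drop (L w - i) := by
        rw [List.drop_eq_getElem_cons (by simpa using hj)]
        simp only [List.getElem_map, List.getElem_range]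
        rw [show L w - (i + 1) + 1 = L w - i by omega]
      have hBQ : B (w, L w - (i + 1)) ≤ Q := (hqB _).trans (by
        rw [size_prod, hsize]
        exact qB.eval_nat_mono (by rw [hsize] at hjL; omega))
      dsimp only
      rw [hdrop]
      by_cases hb : B (w, L w - (i + 1)) = 0
      · rw [if_neg (by simp [hb])]
        refine ⟨?_, by omega⟩
        funext r
        by_cases hr : r = 2
        · subst hr
          simp [hbdef, hb]
        by_cases hr3 : r = 3
        · subst hr3
          simp [Nat.sub_sub]
        by_cases hr4 : r = 4
        · subst hr4
          simp [hb]
        · simp [hr, hr3, hr4]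
      · rw [if_pos (by simpa [isSome_head_unary] using hb)]
        refine ⟨_, 2 * Q + 1, 1, ⟨rfl, by simp; omega⟩, ⟨?_, le_rfl⟩, le_rfl⟩
        funext r
        by_cases hr : r = 2
        · subst hr
          simp [hbdef, hb]
        by_cases hr3 : r = 3
        · subst hr3
          simp [Nat.sub_sub]
        by_cases hr4 : r = 4
        · subst hr4
          simp
        · simp [hr, hr3, hr4]
  · simp
  · funext r
    by_cases hr : r = 2
    · subst hr
      simp
    by_cases hr3 : r = 3
    · subst hr3
      simp
    by_cases hr0 : r = 0
    · subst hr0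
      simp
    · simp [hr, hr3, hr0]
  · have h1 := Nat.mul_le_mul_right (P + (2 * Q + 3) + 2) (hqL w)
    simp only [hsize, Polynomial.eval_add, Polynomial.eval_mul, Polynomial.eval_comp,
      Polynomial.eval_ofNat, Polynomial.eval_one, Polynomial.eval_X] at *
    simp
    rw [← hP, ← hQ]
    rw [show P + 2 * Q + 5 = P + (2 * Q + 3) + 2 by ring]
    omega

end WordContext

/-! ### Counting -/

/-- The number of naturals below `n` with the property `p`. -/
noncomputable def countLT (p : ℕ → Prop) (n : ℕ) : ℕ :=
  open Classical in Nat.count p n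

theorem countLT_succ_of_pos {p : ℕ → Prop} {n : ℕ} (h : p n) :
    countLT p (n + 1) = countLT p n + 1 := by simp [countLT, Nat.count_succ, h]

theorem countLT_succ_of_neg {p : ℕ → Prop} {n : ℕ} (h : ¬ p n) :
    countLT p (n + 1) = countLT p n := by simp [countLT, Nat.count_succ, h]

theorem countLT_zero (p : ℕ → Prop) : countLT p 0 = 0 := by simp [countLT]

open Classical in
theorem countLT_eq_card (p : ℕ → Prop) (n : ℕ) :
    countLT p n = ((Finset.range n).filter p).card := by
  rw [countLT, Nat.count_eq_card_filter_range]

theorem countLT_mono (p : ℕ → Prop) : Monotone (countLT p) := by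
  classical
  exact Nat.count_monotone p

theorem countLT_le (p : ℕ → Prop) (n : ℕ) : countLT p n ≤ n := by
  classical
  exact Nat.count_le _

theorem countLT_congr {p q : ℕ → Prop} {n : ℕ} (h : ∀ m < n, p m ↔ q m) :
    countLT p n = countLT q n := by
  classical
  rw [countLT_eq_card, countLT_eq_card]
  congr 1
  ext m
  simp +contextual [h]

theorem countLT_lt_of_lt {p : ℕ → Prop} {m n : ℕ} (h : m < n) (hm : p m) :
    countLT p m < countLT p n := by
  have := countLT_mono p (Nat.succ_le_of_lt h)
  rw [Nat.succ_eq_add_one, countLT_succ_of_pos hm] at this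
  omega

/-- The number of predecessors with property `p` is strictly increasing along the elements with
property `p`, so it serves as a rank. -/
theorem countLT_injective {p : ℕ → Prop} {m n : ℕ} (hm : p m) (hn : p n)
    (h : countLT p m = countLT p n) : m = n := by
  rcases lt_trichotomy m n with h1 | h1 | h1
  · exact absurd h (countLT_lt_of_lt h1 hm).ne
  · exact h1
  · exact absurd h (countLT_lt_of_lt h1 hn).ne'

theorem exists_countLT_eq {p : ℕ → Prop} {n m : ℕ} (h : m < countLT p n) :
    ∃ v < n, p v ∧ countLT p v = m := by
  induction n with
  | zero => simp [countLT_zero] at h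
  | succ n ih =>
    by_cases hm : m < countLT p n
    · obtain ⟨v, hv, h'⟩ := ih hm
      exact ⟨v, by omega, h'⟩
    · by_cases hp : p n
      · rw [countLT_succ_of_pos hp] at h
        exact ⟨n, by omega, hp, by omega⟩
      · rw [countLT_succ_of_neg hp] at h
        exact absurd h hm

/-- The elements counted are the first `b + 1` with property `p`. This gives both the supply of
marked vertices and the bound on their number. -/
theorem countLT_first (p : ℕ → Prop) (b n : ℕ) :
    countLT (fun v => p v ∧ countLT p v ≤ b) n = min (countLT p n) (b + 1) := by
  induction n with
  | zero => simp [countLT_zero]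
  | succ n ih =>
    by_cases hp : p n
    · rw [countLT_succ_of_pos hp]
      by_cases hb : countLT p n ≤ b
      · rw [countLT_succ_of_pos ⟨hp, hb⟩, ih]
        omega
      · rw [countLT_succ_of_neg fun h => hb h.2, ih]
        omega
    · rw [countLT_succ_of_neg hp, countLT_succ_of_neg fun h => hp h.1, ih]

theorem countLT_le_card {p : ℕ → Prop} {n : ℕ} (S : Finset ℕ) (h : ∀ v < n, p v → v ∈ S) :
    countLT p n ≤ S.card := by
  classical
  rw [countLT_eq_card]
  refine Finset.card_le_card fun v hv => ?_
  rw [Finset.mem_filter, Finset.mem_range] at hv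
  exact h v hv.1 hv.2

theorem exists_finset_countLT (p : ℕ → Prop) (n : ℕ) :
    ∃ S : Finset ℕ, (∀ v, v ∈ S ↔ v < n ∧ p v) ∧ S.card = countLT p n := by
  classical
  exact ⟨(Finset.range n).filter p, fun v => by simp, (countLT_eq_card _ _).symm⟩

theorem countLT_add_countLT_not (p : ℕ → Prop) (n : ℕ) :
    countLT p n + countLT (fun v => ¬ p v) n = n := by
  induction n with
  | zero => simp [countLT_zero]
  | succ n ih =>
    by_cases hp : p n
    · rw [countLT_succ_of_pos hp, countLT_succ_of_neg (by simpa using hp)]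
      omega
    · rw [countLT_succ_of_neg hp, countLT_succ_of_pos (p := fun v => ¬ p v) hp]
      omega

/-- Minimisation by counting: the `t` with no witness up to `t` are those below the least witness,
and `m ≤ n` ensures that the range does not cut them off. -/
theorem countLT_forall_lt_eq {p : ℕ → Prop} {n m : ℕ} (hm : m ≤ n) (h : p m) :
    p (countLT (fun t => ∀ t' < t + 1, ¬ p t') n) ∧
      countLT (fun t => ∀ t' < t + 1, ¬ p t') n ≤ m := by
  classical
  have hex : ∃ m, p m := ⟨m, h⟩
  have hle : Nat.find hex ≤ m := Nat.find_min' hex h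
  have : countLT (fun t => ∀ t' < t + 1, ¬ p t') n = Nat.find hex := by
    rw [countLT_eq_card]
    refine (congrArg Finset.card (?_ : _ = Finset.range (Nat.find hex))).trans
      (Finset.card_range _)
    ext t
    simp only [Finset.mem_filter, Finset.mem_range, Nat.lt_find_iff]
    constructor
    · rintro ⟨-, h⟩ t' ht'
      exact h t' (by omega)
    · intro h'
      refine ⟨?_, fun t' ht' => h' t' (by omega)⟩
      by_contra hc
      exact h' m (by omega) h
  rw [this]
  exact ⟨Nat.find_spec hex, hle⟩

/-! ### The kernel, for a graph on `{0, …, n - 1}` with adjacency relation `A` -/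

namespace TwinKernel

section Defs

variable (A : ℕ → ℕ → Prop) (n : ℕ)

/-- `u` and `v` are adjacent and have the same closed neighbourhood. -/
def IsTwin (u v : ℕ) : Prop := A u v ∧ ∀ w < n, w ≠ u → w ≠ v → (A u w ↔ A v w)

/-- `u` and `v` are adjacent, but not twins. -/
def NonTwinEdge (u v : ℕ) : Prop := A u v ∧ ¬ IsTwin A n u v

/-- The number of neighbours which are not twins. -/
noncomputable def nonTwinDegree (v : ℕ) : ℕ := countLT (fun u => NonTwinEdge A n u v) n

/-- The vertices of large degree, and those with a neighbour of small degree, where only edges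
between vertices which are not twins count. -/
def InCover (t v : ℕ) : Prop :=
  t < nonTwinDegree A n v ∨ ∃ u < n, nonTwinDegree A n u ≤ t ∧ NonTwinEdge A n u v

/-- The size of the cover with threshold `t`. -/
noncomputable def coverSize (t : ℕ) : ℕ := countLT (InCover A n t) n

/-- The first threshold for which the cover is small. -/
noncomputable def threshold : ℕ :=
  countLT (fun t => ∀ t' < t + 1, ¬ coverSize A n t' ≤ t' * t' + t') n

/-- The chosen twin-cover. -/
def Core (v : ℕ) : Prop := InCover A n (threshold A n) v

/-- The size of the chosen twin-cover. -/
noncomputable def coreSize : ℕ := coverSize A n (threshold A n)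

/-- The number of smaller twins. -/
noncomputable def twinRank (v : ℕ) : ℕ := countLT (fun u => IsTwin A n u v) v

variable (c : ℕ)

/-- The number of vertices with at least `c` smaller twins. -/
noncomputable def surplus : ℕ := countLT (fun v => c ≤ twinRank A n v) n

/-- The class of twins of `v` has at least `c` members. -/
def IsFull (v : ℕ) : Prop := ∃ u < n, (u = v ∨ IsTwin A n u v) ∧ twinRank A n u + 1 = c

/-- `v` is the first of a class of twins outside the twin-cover. -/
def IsRep (v : ℕ) : Prop := ¬ Core A n v ∧ twinRank A n v = 0

/-- `w'` is the first vertex of a class which is full iff that of `w` is and which is adjacent to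
`s` and `t`. -/
def IsSimilar (s t w w' : ℕ) : Prop :=
  IsRep A n w' ∧ (IsFull A n c w' ↔ IsFull A n c w) ∧ A s w' ∧ A t w'

/-- `w` is among the first vertices of its kind for some pair in the twin-cover. -/
def IsMarked (w : ℕ) : Prop :=
  IsRep A n w ∧ ∃ s < n, ∃ t < n, Core A n s ∧ Core A n t ∧ A s w ∧ A t w ∧
    countLT (IsSimilar A n c s t w) w ≤ coreSize A n

/-- The vertices of the kernel. -/
def IsKept (v : ℕ) : Prop :=
  v < n ∧ twinRank A n v < c ∧
    (Core A n v ∨ ∃ w < n, (w = v ∨ IsTwin A n w v) ∧ IsMarked A n c w)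

/-- After the deletion of at most `k` vertices, the graph induced on the vertices with property `P`
has a proper colouring with `c` colours. -/
def DeletionColorable (P : ℕ → Prop) (k : ℕ) : Prop :=
  ∃ X : Finset ℕ, X.card ≤ k ∧ ∃ col : ℕ → ℕ, (∀ v, col v < c) ∧
    ∀ u v, A u v → P u → P v → u ∉ X → v ∉ X → col u ≠ col v

/-- `A` is the adjacency relation of a graph on `{0, …, n - 1}`. -/
structure IsGraphOn : Prop where
  symm : ∀ {u v}, A u v → A v u
  irrefl : ∀ u, ¬ A u u
  lt : ∀ {u v}, A u v → u < n

end Defs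

/-! ### Twin classes and the core. -/

variable {A : ℕ → ℕ → Prop} {n : ℕ} (hA : IsGraphOn A n)
include hA

theorem IsGraphOn.ne {u v : ℕ} (h : A u v) : u ≠ v := by
  rintro rfl
  exact hA.irrefl u h

theorem IsTwin.symm {u v : ℕ} (h : IsTwin A n u v) : IsTwin A n v u :=
  ⟨hA.symm h.1, fun w hw h1 h2 => (h.2 w hw h2 h1).symm⟩

theorem IsTwin.adj_iff {u v : ℕ} (h : IsTwin A n u v) {w : ℕ} (h1 : w ≠ u) (h2 : w ≠ v) :
    A u w ↔ A v w := by
  by_cases hw : w < n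
  · exact h.2 w hw h1 h2
  · exact ⟨fun h => absurd (hA.lt (hA.symm h)) hw, fun h => absurd (hA.lt (hA.symm h)) hw⟩

theorem IsTwin.trans {u v w : ℕ} (h : IsTwin A n u v) (h' : IsTwin A n v w) (hne : u ≠ w) :
    IsTwin A n u w := by
  have hvw := IsGraphOn.ne hA h'.1
  have huv := IsGraphOn.ne hA h.1
  refine ⟨(IsTwin.adj_iff hA h hne.symm hvw.symm).2 h'.1, fun x _ h1 h2 => ?_⟩
  by_cases hx : x = v
  · subst hx
    exact ⟨fun _ => hA.symm h'.1, fun _ => h.1⟩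
  · rw [IsTwin.adj_iff hA h h1 hx, IsTwin.adj_iff hA h' hx h2]

/-- Being equal or twins is an equivalence relation. -/
theorem same_symm {u v : ℕ} (h : u = v ∨ IsTwin A n u v) : v = u ∨ IsTwin A n v u :=
  h.imp Eq.symm (IsTwin.symm hA)

theorem same_trans {u v w : ℕ} (h : u = v ∨ IsTwin A n u v) (h' : v = w ∨ IsTwin A n v w) :
    u = w ∨ IsTwin A n u w := by
  rcases h with rfl | h
  · exact h'
  rcases h' with rfl | h'
  · exact Or.inr h
  · by_cases hne : u = w
    · exact Or.inl hne
    · exact Or.inr (IsTwin.trans hA h h' hne)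

/-- Adjacency between different classes depends on the classes only. -/
theorem adj_of_same {u u' v v' : ℕ} (hu : u = u' ∨ IsTwin A n u u')
    (hv : v = v' ∨ IsTwin A n v v') (hne : u' ≠ v') (h : A u v) : A u' v' := by
  by_cases hs : u' = v' ∨ IsTwin A n u' v'
  · exact (hs.resolve_left hne).1
  have h1 : A u' v := by
    rcases hu with rfl | hu
    · exact h
    · refine (IsTwin.adj_iff hA hu (IsGraphOn.ne hA h).symm ?_).1 h
      rintro rfl
      exact hs hv
  rcases hv with rfl | hv
  · exact h1
  · refine hA.symm ((IsTwin.adj_iff hA hv (IsGraphOn.ne hA h1) hne).1 (hA.symm h1))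

/-- Expressed through a fixed representative `w`, the ranks of all members of a class count the same
predicate, so the general facts on `countLT` apply. The vertex `v` is not counted, since only
numbers below `v` are. -/
theorem twinRank_eq {v w : ℕ} (h : v = w ∨ IsTwin A n v w) :
    twinRank A n v = countLT (fun u => u = w ∨ IsTwin A n u w) v := by
  refine countLT_congr fun u hu => ⟨fun h' => same_trans hA (Or.inr h') h, fun h' => ?_⟩
  exact (same_trans hA h' (same_symm hA h)).resolve_left hu.ne

theorem twinRank_injective {u v : ℕ} (h : u = v ∨ IsTwin A n u v)
    (hr : twinRank A n u = twinRank A n v) : u = v := by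
  rw [twinRank_eq hA h, twinRank_eq hA (Or.inl rfl)] at hr
  exact countLT_injective (p := fun u => u = v ∨ IsTwin A n u v) h (Or.inl rfl) hr

theorem exists_twinRank_eq {v m : ℕ} (h : m ≤ twinRank A n v) :
    ∃ u ≤ v, (u = v ∨ IsTwin A n u v) ∧ twinRank A n u = m := by
  rw [twinRank_eq hA (Or.inl rfl)] at h
  have h' : m < countLT (fun u => u = v ∨ IsTwin A n u v) (v + 1) := by
    rw [countLT_succ_of_pos (Or.inl rfl)]
    omega
  obtain ⟨u, hu, h1, h2⟩ := exists_countLT_eq h'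
  exact ⟨u, by omega, h1, by rw [twinRank_eq hA h1, h2]⟩

theorem NonTwinEdge.symm {u v : ℕ} (h : NonTwinEdge A n u v) : NonTwinEdge A n v u :=
  ⟨hA.symm h.1, fun h' => h.2 (IsTwin.symm hA h')⟩

theorem nonTwinEdge_of_same {u v w : ℕ} (h : u = v ∨ IsTwin A n u v)
    (hw : NonTwinEdge A n w u) : NonTwinEdge A n w v := by
  have hns : ¬ (w = v ∨ IsTwin A n w v) := fun h' => by
    rcases same_trans hA h' (same_symm hA h) with h1 | h1
    · exact hA.irrefl _ (h1 ▸ hw.1)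
    · exact hw.2 h1
  exact ⟨adj_of_same hA (Or.inl rfl) h (fun h' => hns (Or.inl h')) hw.1,
    fun h' => hns (Or.inr h')⟩

/-- Members of a class have the same non-twin neighbours, hence the same non-twin degree, so the
core is a union of classes. -/
theorem core_of_same {u v : ℕ} (h : u = v ∨ IsTwin A n u v) (hu : Core A n u) : Core A n v := by
  have hdeg : nonTwinDegree A n u = nonTwinDegree A n v := countLT_congr fun w _ =>
    ⟨nonTwinEdge_of_same hA h, nonTwinEdge_of_same hA (same_symm hA h)⟩
  rcases hu with hu | ⟨w, hw, hd, he⟩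
  · exact Or.inl (hdeg ▸ hu)
  · exact Or.inr ⟨w, hw, hd, nonTwinEdge_of_same hA h he⟩

/-- The core covers every non-twin edge: an endpoint of large degree belongs to it, and one of small
degree puts the other endpoint into it. -/
theorem isTwin_of_adj {u v : ℕ} (h : A u v) (hu : ¬ Core A n u) (hv : ¬ Core A n v) :
    IsTwin A n u v := by
  by_contra ht
  refine hv (Or.inr ⟨u, hA.lt h, ?_, h, ht⟩)
  by_contra hd
  exact hu (Or.inl (by omega))

theorem core_lt {v : ℕ} (h : Core A n v) : v < n := by
  rcases h with h | ⟨u, -, -, h⟩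
  · obtain ⟨u, -, hu, -⟩ := exists_countLT_eq h
    exact hA.lt (hA.symm hu.1)
  · exact hA.lt (hA.symm h.1)

omit hA in
theorem coreSize_le {m : ℕ} (hm : m ≤ n) (h : coverSize A n m ≤ m * m + m) :
    coreSize A n ≤ m * m + m := by
  obtain ⟨h1, h2⟩ := countLT_forall_lt_eq (p := fun t => coverSize A n t ≤ t * t + t) hm h
  exact h1.trans (Nat.add_le_add (Nat.mul_le_mul h2 h2) h2)

/-- The size of the core is bounded in terms of any vertex cover of the edges between vertices
which are not twins. -/
theorem coreSize_le_of_cover (C : Finset ℕ) (hn : C.card ≤ n)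
    (hC : ∀ u v, NonTwinEdge A n u v → u ∈ C ∨ v ∈ C) :
    coreSize A n ≤ C.card * C.card + C.card := by
  classical
  refine coreSize_le hn ?_
  -- The non-twin neighbours of a vertex outside `C` all lie in `C`, so it has small degree. If it
  -- is in the cover nevertheless, it is one of the at most `C.card` neighbours of a vertex of small
  -- degree in `C`.
  have h : ∀ v < n, InCover A n C.card v →
      v ∈ C ∪ (C.filter fun u => nonTwinDegree A n u ≤ C.card).biUnion fun u =>
        (Finset.range n).filter fun v => NonTwinEdge A n v u := by
    intro v hv h
    rw [Finset.mem_union, Finset.mem_biUnion]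
    by_contra hvC
    push Not at hvC
    obtain ⟨hvC, hN⟩ := hvC
    rcases h with h | ⟨u, hu, hd, he⟩
    · refine absurd h (not_lt.2 (countLT_le_card C fun u _ he => ?_))
      exact (hC u v he).resolve_right hvC
    · refine hN u ?_ ?_
      · exact Finset.mem_filter.2 ⟨(hC u v he).resolve_right hvC, hd⟩
      · exact Finset.mem_filter.2 ⟨Finset.mem_range.2 hv, NonTwinEdge.symm hA he⟩
  refine (countLT_le_card _ h).trans ((Finset.card_union_le _ _).trans ?_)
  rw [add_comm]
  refine Nat.add_le_add_right ((Finset.card_biUnion_le_card_mul _ _ C.card fun u hu => ?_).trans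
    (Nat.mul_le_mul_right _ (Finset.card_filter_le _ _))) _
  rw [Finset.mem_filter] at hu
  rw [← countLT_eq_card]
  exact hu.2

end TwinKernel

theorem countLT_le_of_imp {p q : ℕ → Prop} {n : ℕ} (h : ∀ m < n, p m → q m) :
    countLT p n ≤ countLT q n := by
  obtain ⟨S, hS, hcard⟩ := exists_finset_countLT q n
  rw [← hcard]
  exact countLT_le_card S fun v hv hp => (hS v).2 ⟨hv, h v hv hp⟩

/-! ### Correctness of truncating and dropping twin classes, and the number of kept vertices. -/

namespace TwinKernel

variable {A : ℕ → ℕ → Prop} {n : ℕ} {c : ℕ}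

theorem DeletionColorable.mono {P Q : ℕ → Prop} {k l : ℕ} (h : DeletionColorable A c P k)
    (hkl : k ≤ l) (hPQ : ∀ v, Q v → P v) : DeletionColorable A c Q l := by
  obtain ⟨X, hX, col, hcol, h⟩ := h
  exact ⟨X, hX.trans hkl, col, hcol, fun u v huv hu hv => h u v huv (hPQ u hu) (hPQ v hv)⟩

theorem deletionColorable_of_rank (hA : IsGraphOn A n) {k l : ℕ}
    (h : DeletionColorable A c (fun v => twinRank A n v < c) k) (hl : k + surplus A n c ≤ l) :
    DeletionColorable A c (fun _ => True) l := by
  classical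
  obtain ⟨X, hX, col, hcol, h⟩ := h
  obtain ⟨S, hS, hcard⟩ := exists_finset_countLT (fun v => c ≤ twinRank A n v) n
  have hout : ∀ {u v}, A u v → u ∉ X ∪ S → twinRank A n u < c ∧ u ∉ X := by
    intro u v huv hu
    rw [Finset.mem_union, not_or] at hu
    exact ⟨not_le.1 fun hc => hu.2 ((hS u).2 ⟨hA.lt huv, hc⟩), hu.1⟩
  refine ⟨X ∪ S, (Finset.card_union_le _ _).trans ((Nat.add_le_add hX hcard.le).trans hl), col,
    hcol, fun u v huv _ _ hu hv => ?_⟩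
  obtain ⟨h1, h2⟩ := hout huv hu
  obtain ⟨h3, h4⟩ := hout (hA.symm huv) hv
  exact h u v huv h1 h3 h2 h4

/-- Without the core, all edges join twins, and the ranks within each class are distinct and below
`c`. -/
theorem deletionColorable_coreSize (hA : IsGraphOn A n) (hc : 0 < c) :
    DeletionColorable A c (fun v => twinRank A n v < c) (coreSize A n) := by
  obtain ⟨S, hS, hcard⟩ := exists_finset_countLT (Core A n) n
  refine ⟨S, hcard.le, fun v => if twinRank A n v < c then twinRank A n v else 0, fun v => ?_,
    fun u v huv hu hv huS hvS => ?_⟩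
  · dsimp only
    split_ifs with h
    · exact h
    · exact hc
  · have ht : IsTwin A n u v := isTwin_of_adj hA huv (fun h => huS ((hS u).2 ⟨hA.lt huv, h⟩))
      fun h => hvS ((hS v).2 ⟨hA.lt (hA.symm huv), h⟩)
    simp only [hu, hv, if_true]
    exact fun h => IsGraphOn.ne hA huv (twinRank_injective hA (Or.inr ht) h)

/-- An exchange argument: within each class the survivors are shifted to the smallest ranks, and
each carries its colour along. As a class is a clique, these ranks are below `c`. At least `n - k`
vertices survive among the `n - surplus` of small rank, which gives both claims. -/
theorem surplus_le_and_deletionColorable (hA : IsGraphOn A n) {k : ℕ}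
    (h : DeletionColorable A c (fun _ => True) k) :
    surplus A n c ≤ k ∧
      DeletionColorable A c (fun v => twinRank A n v < c) (k - surplus A n c) := by
  classical
  obtain ⟨X, hX, col, hcol, h⟩ := h
  set Y := Finset.range n \ X with hY
  have hYX : ∀ {y}, y ∈ Y → y ∉ X := fun hy => (Finset.mem_sdiff.1 hy).2
  set r : ℕ → ℕ := fun y => countLT (fun u => u ∈ Y ∧ (u = y ∨ IsTwin A n u y)) y with hr
  have hrank : ∀ y, r y ≤ twinRank A n y := fun y => by
    rw [twinRank_eq hA (Or.inl rfl)]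
    exact countLT_le_of_imp fun m _ h => h.2
  have hrc : ∀ y ∈ Y, r y < c := by
    intro y hy
    obtain ⟨S, hS, hcard⟩ :=
      exists_finset_countLT (fun u => u ∈ Y ∧ (u = y ∨ IsTwin A n u y)) (y + 1)
    rw [countLT_succ_of_pos ⟨hy, Or.inl rfl⟩] at hcard
    -- The surviving members of a class up to `y` are pairwise adjacent and so have distinct
    -- colours.
    have : S.card ≤ (Finset.range c).card := by
      refine Finset.card_le_card_of_injOn col
        (fun u _ => Finset.mem_coe.2 (Finset.mem_range.2 (hcol u))) fun u hu v hv huv => ?_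
      obtain ⟨-, huY, hu⟩ := (hS u).1 hu
      obtain ⟨-, hvY, hv⟩ := (hS v).1 hv
      rcases same_trans hA hu (same_symm hA hv) with h1 | h1
      · exact h1
      · exact absurd huv (h u v h1.1 trivial trivial (hYX huY) (hYX hvY))
    rw [Finset.card_range] at this
    change countLT _ y < c
    omega
  -- The vertex `φ y` is the member of the class of `y` whose rank among all members equals the rank
  -- of `y` among the survivors.
  choose φ hφle hφ hφr using fun y => exists_twinRank_eq hA (hrank y)
  have hinj : Set.InjOn φ Y := by
    intro y hy y' hy' he
    have hs : y = y' ∨ IsTwin A n y y' :=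
      same_trans hA (same_symm hA (hφ y)) (he ▸ hφ y')
    have hre : r y = r y' := by rw [← hφr, ← hφr, he]
    have hr' : r y = countLT (fun u => u ∈ Y ∧ (u = y' ∨ IsTwin A n u y')) y :=
      countLT_congr fun u _ => and_congr_right fun _ =>
        ⟨fun h => same_trans hA h hs, fun h => same_trans hA h (same_symm hA hs)⟩
    rw [hr'] at hre
    exact countLT_injective (p := fun u => u ∈ Y ∧ (u = y' ∨ IsTwin A n u y'))
      ⟨hy, hs⟩ ⟨hy', Or.inl rfl⟩ hre
  obtain ⟨V, hV, hVcard⟩ := exists_finset_countLT (fun v => twinRank A n v < c) n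
  have hsum := countLT_add_countLT_not (fun v => twinRank A n v < c) n
  simp only [not_lt] at hsum
  rw [← hVcard] at hsum
  change V.card + surplus A n c = n at hsum
  have hsub : Y.image φ ⊆ V := by
    intro z hz
    obtain ⟨y, hy, rfl⟩ := Finset.mem_image.1 hz
    refine (hV _).2 ⟨(hφle y).trans_lt (Finset.mem_range.1 (Finset.mem_sdiff.1 hy).1), ?_⟩
    rw [hφr]
    exact hrc y hy
  have hcardY : (Y.image φ).card = Y.card := Finset.card_image_of_injOn hinj
  have hle := Finset.card_le_card hsub
  have hYn : n - X.card ≤ Y.card := by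
    have := Finset.le_card_sdiff X (Finset.range n)
    rwa [Finset.card_range] at this
  refine ⟨by omega, V \ Y.image φ, ?_, fun z => col (Function.invFunOn φ Y z), fun z => hcol _,
    ?_⟩
  · rw [Finset.card_sdiff_of_subset hsub]
    omega
  · have hinv : ∀ {u v}, A u v → twinRank A n u < c → u ∉ V \ Y.image φ →
        Function.invFunOn φ Y u ∈ Y ∧ φ (Function.invFunOn φ Y u) = u := by
      intro u v huv hu hun
      have huY : u ∈ Y.image φ := by
        by_contra hc
        exact hun (Finset.mem_sdiff.2 ⟨(hV u).2 ⟨hA.lt huv, hu⟩, hc⟩)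
      exact Function.invFunOn_pos (by simpa using huY)
    intro u v huv hu hv huX hvX
    obtain ⟨h1, h2⟩ := hinv huv hu huX
    obtain ⟨h3, h4⟩ := hinv (hA.symm huv) hv hvX
    refine h _ _ ?_ trivial trivial (hYX h1) (hYX h3)
    have hs1 := hφ (Function.invFunOn φ Y u)
    have hs2 := hφ (Function.invFunOn φ Y v)
    rw [h2] at hs1
    rw [h4] at hs2
    refine adj_of_same hA hs1 hs2 (fun he => ?_) huv
    rw [he, h4] at h2
    exact IsGraphOn.ne hA huv h2.symm

/-- A vertex which is not marked has many marked vertices of the same kind. -/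
theorem exists_marked_similar {w s t : ℕ} (hA : IsGraphOn A n) (hw : IsRep A n w) (hs : Core A n s)
    (ht : Core A n t) (hsw : A s w) (htw : A t w) (hm : ¬ IsMarked A n c w) :
    ∃ M : Finset ℕ, coreSize A n < M.card ∧
      ∀ w' ∈ M, w' < n ∧ IsMarked A n c w' ∧ IsSimilar A n c s t w w' := by
  have hcount : coreSize A n < countLT (IsSimilar A n c s t w) w := by
    by_contra hcon
    exact hm ⟨hw, s, core_lt hA hs, t, core_lt hA ht, hs, ht, hsw, htw, by omega⟩
  obtain ⟨M, hM, hcard⟩ := exists_finset_countLT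
    (fun v => IsSimilar A n c s t w v ∧ countLT (IsSimilar A n c s t w) v ≤ coreSize A n) w
  rw [countLT_first] at hcard
  refine ⟨M, by omega, fun w' hw' => ?_⟩
  obtain ⟨h1, h2, h3⟩ := (hM w').1 hw'
  refine ⟨h1.trans (hA.lt (hA.symm hsw)), ⟨h2.1, s, core_lt hA hs, t, core_lt hA ht, hs, ht,
    h2.2.2.1, h2.2.2.2, le_trans (le_of_eq ?_) h3⟩, h2⟩
  refine countLT_congr fun v _ => ?_
  simp only [IsSimilar, h2.2.1]

theorem isFull_congr (hA : IsGraphOn A n) {u v : ℕ} (h : u = v ∨ IsTwin A n u v)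
    (hu : IsFull A n c u) : IsFull A n c v := by
  obtain ⟨w, hw, hs, hr⟩ := hu
  exact ⟨w, hw, same_trans hA hs h, hr⟩

/-- The vertices not in the kernel can be coloured as well. -/
theorem deletionColorable_of_isKept (hA : IsGraphOn A n) (hc : c = 1 ∨ c = 2) {k : ℕ}
    (hk : k ≤ coreSize A n) (h : DeletionColorable A c (IsKept A n c) k) :
    DeletionColorable A c (fun v => twinRank A n v < c) k := by
  classical
  obtain ⟨X, hX, col, hcol, h⟩ := h
  have hkeep : ∀ {u v}, A u v → twinRank A n u < c → Core A n u → IsKept A n c u :=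
    fun huv hu hcu => ⟨hA.lt huv, hu, Or.inl hcu⟩
  -- the first twin of a vertex outside the kernel is not marked
  have hrep : ∀ u, u < n → twinRank A n u < c → ¬ IsKept A n c u → ∃ w ≤ u,
      (w = u ∨ IsTwin A n w u) ∧ IsRep A n w ∧ ¬ IsMarked A n c w := by
    intro u hu hr hk
    obtain ⟨w, hwu, hw, hw0⟩ := exists_twinRank_eq hA (Nat.zero_le (twinRank A n u))
    refine ⟨w, hwu, hw, ⟨fun hcw => ?_, hw0⟩, fun hm => ?_⟩
    · exact hk ⟨hu, hr, Or.inl (core_of_same hA hw hcw)⟩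
    · exact hk ⟨hu, hr, Or.inr ⟨w, hwu.trans_lt hu, hw, hm⟩⟩
  have hadj : ∀ {u w v}, (w = u ∨ IsTwin A n w u) → ¬ Core A n u → Core A n v → A v u →
      A v w := by
    intro u w v hw hu hv hvu
    refine adj_of_same hA (Or.inl rfl) (same_symm hA hw) ?_ hvu
    rintro rfl
    exact hu (core_of_same hA hw hv)
  -- full classes outside the kernel have no neighbours in the core outside `X`
  have hfull : ∀ u v, A v u → twinRank A n u < c → ¬ IsKept A n c u → ¬ Core A n u → Core A n v →
      twinRank A n v < c → v ∉ X → ¬ IsFull A n c u := by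
    intro u v hvu hru hku hcu hcv hrv hvX hfu
    obtain ⟨w, hwu, hw, hwr, hwm⟩ := hrep u (hA.lt (hA.symm hvu)) hru hku
    have hvw := hadj hw hcu hcv hvu
    have hfw : IsFull A n c w := isFull_congr hA (same_symm hA hw) hfu
    obtain ⟨M, hMcard, hM⟩ := exists_marked_similar hA hwr hcv hcv hvw hvw hwm
    -- A marked full class disjoint from `X` would form, with `v`, a clique on `c + 1` surviving
    -- kept vertices.
    have hhit : ∀ w' ∈ M, ∃ x ∈ X, x = w' ∨ IsTwin A n x w' := by
      intro w' hw'
      obtain ⟨hn', hm', hr', hf', hv', -⟩ := hM w' hw'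
      by_contra hcon
      push Not at hcon
      have hkept : ∀ x, x < n → (x = w' ∨ IsTwin A n x w') → twinRank A n x < c →
          IsKept A n c x := fun x hx hs hr => ⟨hx, hr, Or.inr ⟨w', hn', same_symm hA hs, hm'⟩⟩
      have hnX : ∀ x, (x = w' ∨ IsTwin A n x w') → x ∉ X := fun x hs hx =>
        hs.elim (hcon x hx).1 (hcon x hx).2
      have hkv := hkeep hvu hrv hcv
      have hkw' : IsKept A n c w' := hkept w' hn' (Or.inl rfl) (by
        rw [hr'.2]; rcases hc with rfl | rfl <;> omega)
      have h1 := h v w' hv' hkv hkw' hvX (hnX _ (Or.inl rfl))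
      have h2 := hcol v
      have h3 := hcol w'
      obtain ⟨y, hy, hsy, hry⟩ := hf'.2 hfw
      rcases hc with rfl | rfl
      · omega
      · have hne : y ≠ w' := by
          rintro rfl
          have := hr'.2
          omega
        have hty := hsy.resolve_left hne
        have hky := hkept y hy hsy (by omega)
        have hvy : A v y := hadj hsy hr'.1 hcv hv'
        have h4 := h v y hvy hkv hky hvX (hnX _ hsy)
        have h5 := h y w' hty.1 hky hkw' (hnX _ hsy) (hnX _ (Or.inl rfl))
        have h6 := hcol y
        omega
    choose! g hgX hg using hhit
    -- Members of `M` have rank `0`, so they represent different classes, and the vertices of `X`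
    -- meeting these classes are distinct.
    have : M.card ≤ X.card := by
      refine Finset.card_le_card_of_injOn g (fun w' hw' => hgX w' hw') ?_
      intro w₁ h1 w₂ h2 he
      have hs := same_trans hA (same_symm hA (hg w₁ h1)) (he ▸ hg w₂ h2)
      exact twinRank_injective hA hs (by rw [(hM w₁ h1).2.2.1.2, (hM w₂ h2).2.2.1.2])
    omega
  have hc0 : 0 < c := by rcases hc with rfl | rfl <;> omega
  set nbr : ℕ → ℕ → Prop := fun u s => Core A n s ∧ twinRank A n s < c ∧ s ∉ X ∧ A s u with hnbr
  -- A dropped full class is coloured by rank. A smaller one gets the colour opposite to that of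
  -- some surviving core neighbour; `mixed` edges below show that the choice is irrelevant. The
  -- remaining values `0` only keep colours below `c`.
  set col' : ℕ → ℕ := fun u =>
    if IsKept A n c u then col u
    else if IsFull A n c u then (if twinRank A n u < c then twinRank A n u else 0)
    else if hs : ∃ s, nbr u s then c - 1 - col hs.choose else 0 with hcol'
  have hmixed : ∀ u v, A v u → twinRank A n u < c → twinRank A n v < c → v ∉ X →
      ¬ IsKept A n c u → Core A n v → col' u ≠ col' v := by
    intro u v hvu hru hrv hvX hku hcv
    have hcu : ¬ Core A n u := fun hcu => hku (hkeep (hA.symm hvu) hru hcu)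
    have hnf := hfull u v hvu hru hku hcu hcv hrv hvX
    have hkv := hkeep hvu hrv hcv
    have hex : ∃ s, nbr u s := ⟨v, hcv, hrv, hvX, hvu⟩
    have e1 : col' u = c - 1 - col hex.choose := by
      simp only [hcol', if_neg hku, if_neg hnf, dif_pos hex]
    have e2 : col' v = col v := by simp only [hcol', if_pos hkv]
    rw [e1, e2]
    obtain ⟨hcs, hrs, hsX, hsu⟩ := hex.choose_spec
    generalize hex.choose = s at *
    have hks := hkeep hsu hrs hcs
    -- For `c = 1` every class is full.
    have hc2 : c = 2 := by
      refine hc.resolve_left ?_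
      rintro rfl
      exact hnf ⟨u, hA.lt (hA.symm hvu), Or.inl rfl, by omega⟩
    obtain ⟨w, hwu, hw, hwr, hwm⟩ := hrep u (hA.lt (hA.symm hvu)) hru hku
    obtain ⟨M, hMcard, hM⟩ := exists_marked_similar hA hwr hcs hcv (hadj hw hcu hcs hsu)
      (hadj hw hcu hcv hvu) hwm
    -- More marked vertices are adjacent to both `s` and `v` than `X` can contain. A surviving one
    -- forces `s` and `v` to have the same one of two colours.
    obtain ⟨w', hw', hw'X⟩ : ∃ w' ∈ M, w' ∉ X := by
      by_contra hcon
      push Not at hcon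
      have := Finset.card_le_card (show M ⊆ X from hcon)
      omega
    obtain ⟨hn', hm', hr', hf', hs', hv'⟩ := hM w' hw'
    have hkw' : IsKept A n c w' :=
      ⟨hn', by rw [hr'.2]; exact hc0, Or.inr ⟨w', hn', Or.inl rfl, hm'⟩⟩
    have h1 := h s w' hs' hks hkw' hsX hw'X
    have h2 := h v w' hv' hkv hkw' hvX hw'X
    have h3 := hcol s
    have h4 := hcol v
    have h5 := hcol w'
    omega
  refine ⟨X, hX, col', fun v => ?_, ?_⟩
  · simp only [hcol']
    split_ifs with h1 h2 h3 h4
    · exact hcol v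
    · exact h3
    · exact hc0
    · omega
    · exact hc0
  have main : ∀ u v, A u v → twinRank A n u < c → twinRank A n v < c → u ∉ X → v ∉ X →
      ¬ IsKept A n c u → col' u ≠ col' v := by
    intro u v huv hru hrv huX hvX hku
    by_cases hcv : Core A n v
    · exact hmixed u v (hA.symm huv) hru hrv hvX hku hcv
    have hcu : ¬ Core A n u := fun hcu => hku (hkeep huv hru hcu)
    have ht := isTwin_of_adj hA huv hcu hcv
    have hkv : ¬ IsKept A n c v := by
      rintro ⟨-, -, hkv⟩
      obtain ⟨w, hwn, hw, hm⟩ := hkv.resolve_left hcv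
      exact hku ⟨hA.lt huv, hru, Or.inr ⟨w, hwn, same_trans hA hw
        (Or.inr (IsTwin.symm hA ht)), hm⟩⟩
    have hne : twinRank A n u ≠ twinRank A n v := fun he =>
      IsGraphOn.ne hA huv (twinRank_injective hA (Or.inr ht) he)
    -- Two members of one class with distinct ranks below `c` force `c = 2`, and one of them has
    -- rank `1`.
    have hfu : IsFull A n c u := by
      rcases hc with rfl | rfl
      · omega
      by_cases hu1 : twinRank A n u = 1
      · exact ⟨u, hA.lt huv, Or.inl rfl, by omega⟩
      · exact ⟨v, hA.lt (hA.symm huv), Or.inr (IsTwin.symm hA ht), by omega⟩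
    have hfv := isFull_congr hA (Or.inr ht) hfu
    simp only [hcol', if_neg hku, if_neg hkv, if_pos hfu, if_pos hfv, if_pos hru, if_pos hrv]
    exact hne
  intro u v huv hru hrv huX hvX
  by_cases hku : IsKept A n c u
  · by_cases hkv : IsKept A n c v
    · simp only [hcol', if_pos hku, if_pos hkv]
      exact h u v huv hku hkv huX hvX
    · exact (main v u (hA.symm huv) hrv hru hvX huX hkv).symm
  · exact main u v huv hru hrv huX hvX hku

/-- Correctness of the kernel. -/
theorem deletionColorable_iff (hA : IsGraphOn A n) (hc : c = 1 ∨ c = 2) (k : ℕ) :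
    DeletionColorable A c (fun _ => True) k ↔ surplus A n c ≤ k ∧
      DeletionColorable A c (IsKept A n c) (min (k - surplus A n c) (coreSize A n)) := by
  constructor
  · intro h
    obtain ⟨h1, h2⟩ := surplus_le_and_deletionColorable hA h
    refine ⟨h1, ?_⟩
    rcases le_total (k - surplus A n c) (coreSize A n) with h3 | h3
    · rw [min_eq_left h3]
      exact h2.mono le_rfl fun v hv => hv.2.1
    · rw [min_eq_right h3]
      exact (deletionColorable_coreSize hA (by omega)).mono le_rfl fun v hv => hv.2.1
  · rintro ⟨h1, h2⟩
    exact deletionColorable_of_rank hA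
      (deletionColorable_of_isKept hA hc (min_le_right _ _) h2) (by omega)

/-- The size of the kernel. -/
theorem countLT_isKept_le (hA : IsGraphOn A n) (hc : c ≤ 2) :
    countLT (IsKept A n c) n ≤
      coreSize A n + 4 * (coreSize A n * coreSize A n) * (coreSize A n + 1) := by
  classical
  obtain ⟨S, hS, hScard⟩ := exists_finset_countLT (Core A n) n
  change S.card = coreSize A n at hScard
  set b := coreSize A n with hb
  -- The Boolean `τ` replaces the reference vertex of `IsSimilar`, leaving two kinds for each pair
  -- of core vertices.
  set Q : ℕ → ℕ → Bool → ℕ → Prop := fun s t τ w =>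
    IsRep A n w ∧ (IsFull A n c w ↔ τ = true) ∧ A s w ∧ A t w with hQ
  set M : Finset ℕ := ((S ×ˢ S) ×ˢ Finset.univ).biUnion fun p : (ℕ × ℕ) × Bool =>
    (Finset.range n).filter fun w => Q p.1.1 p.1.2 p.2 w ∧ countLT (Q p.1.1 p.1.2 p.2) w ≤ b
    with hMdef
  have hM : ∀ w < n, IsMarked A n c w → w ∈ M := by
    rintro w hw ⟨hr, s, hs, t, ht, hcs, hct, hsw, htw, hcount⟩
    refine Finset.mem_biUnion.2 ⟨((s, t), decide (IsFull A n c w)), ?_, ?_⟩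
    · simp [hS, hs, ht, hcs, hct, em]
    · refine Finset.mem_filter.2 ⟨Finset.mem_range.2 hw, ⟨hr, by simp, hsw, htw⟩,
        le_trans (le_of_eq (countLT_congr fun v _ => ?_)) hcount⟩
      simp [hQ, IsSimilar]
  have hMcard : M.card ≤ b * b * 2 * (b + 1) := by
    refine (Finset.card_biUnion_le_card_mul _ _ (b + 1) fun p _ => ?_).trans (le_of_eq ?_)
    · refine (le_of_eq ?_).trans (min_le_right (countLT (Q p.1.1 p.1.2 p.2) n) _)
      rw [← countLT_first, countLT_eq_card]
      congr
    · simp [hScard]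
  have hsub : ∀ v < n, IsKept A n c v → v ∈ S ∪ M.biUnion fun w =>
      (Finset.range n).filter fun v => (w = v ∨ IsTwin A n w v) ∧ twinRank A n v < c := by
    rintro v hv ⟨-, hr, hcv | ⟨w, hw, hs, hm⟩⟩
    · exact Finset.mem_union_left _ ((hS v).2 ⟨hv, hcv⟩)
    · exact Finset.mem_union_right _ (Finset.mem_biUnion.2 ⟨w, hM w hw hm,
        Finset.mem_filter.2 ⟨Finset.mem_range.2 hv, hs, hr⟩⟩)
  refine (countLT_le_card _ hsub).trans ((Finset.card_union_le _ _).trans ?_)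
  rw [hScard]
  -- Each marked class contributes at most one vertex for every rank below `c`.
  refine Nat.add_le_add_left ((Finset.card_biUnion_le_card_mul _ _ 2 fun w _ => ?_).trans ?_) _
  · refine (Finset.card_le_card_of_injOn (t := Finset.range c) (twinRank A n) ?_ ?_).trans
      (by simpa using hc)
    · intro v hv
      simpa using (Finset.mem_filter.1 (Finset.mem_coe.1 hv)).2.2
    · intro v hv v' hv' he
      have h1 := (Finset.mem_filter.1 (Finset.mem_coe.1 hv)).2.1
      have h2 := (Finset.mem_filter.1 (Finset.mem_coe.1 hv')).2.1
      exact twinRank_injective hA (same_trans hA (same_symm hA h1) h2) he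
  · calc M.card * 2 ≤ b * b * 2 * (b + 1) * 2 := Nat.mul_le_mul_right _ hMcard
      _ = 4 * (b * b) * (b + 1) := by ring

end TwinKernel

/-! ### Definable predicates, bounded quantifiers and arithmetic. -/

namespace WordContext

variable {C D : Type} [WordContext C] [WordContext D]

/-- The characteristic function of `P` is polynomially definable. -/
def PolyDec (P : C → Prop) : Prop :=
  open Classical in PolyDef fun c => if P c then 1 else 0

namespace PolyDef

theorem weaken {f : C → ℕ} (hf : PolyDef f) : PolyDef fun p : C × ℕ => f p.1 :=
  hf.rename Prod.fst Fin.succ (fun _ => rfl) fun _ _ => rfl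

theorem last : PolyDef fun p : C × ℕ => p.2 := of_var (C := C × ℕ) 0 fun _ => rfl

theorem ite {P : C → Prop} {f g : C → ℕ} (hP : PolyDec P) (hf : PolyDef f) (hg : PolyDef g) :
    PolyDef fun c => open Classical in if P c then f c else g c := by
  classical
  refine (cond hP hf hg).congr fun c => ?_
  by_cases h : P c <;> simp [h]

/-- Partial sums satisfy the bound required by `recursion`: they have polynomially many terms, each
polynomially bounded. -/
theorem sum {f : C → ℕ → ℕ} {n : C → ℕ} (hf : PolyDef fun p : C × ℕ => f p.1 p.2)
    (hn : PolyDef n) : PolyDef fun c => ∑ i ∈ Finset.range (n c), f c i := by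
  have hstep : PolyDef fun p : (C × ℕ) × ℕ => p.1.2 + f p.1.1 p.2 := by
    refine add last.weaken (hf.rename (fun p : (C × ℕ) × ℕ => (p.1.1, p.2))
      (Fin.cons 0 fun j => j.succ.succ) (fun _ => rfl) fun p => ?_)
    exact Fin.cases rfl fun j => rfl
  have hval : ∀ c i, recVal (fun _ => 0) (fun p : (C × ℕ) × ℕ => p.1.2 + f p.1.1 p.2) c i =
      ∑ j ∈ Finset.range i, f c j := by
    intro c i
    induction i with
    | zero => rfl
    | succ i ih => rw [Finset.sum_range_succ, ← ih]; rfl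
  obtain ⟨⟨qf, hqf⟩, -⟩ := id hf
  obtain ⟨⟨qn, hqn⟩, -⟩ := id hn
  refine (recursion (const 0) hstep hn ⟨qn * qf.comp (Polynomial.X + qn), fun c i hi => ?_⟩).congr
    fun c => hval c _
  rw [hval]
  refine (Finset.sum_le_card_nsmul _ _ (qf.eval (size c + qn.eval (size c)))
    fun j hj => ?_).trans ?_
  · refine (hqf (c, j)).trans (qf.eval_nat_mono ?_)
    rw [size_prod]
    have := Finset.mem_range.1 hj
    have := hqn c
    omega
  · rw [Finset.card_range, smul_eq_mul, Polynomial.eval_mul, Polynomial.eval_comp,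
      Polynomial.eval_add, Polynomial.eval_X]
    exact Nat.mul_le_mul_right _ (hi.trans (hqn c))

theorem mul {f g : C → ℕ} (hf : PolyDef f) (hg : PolyDef g) : PolyDef fun c => f c * g c :=
  (sum (f := fun c _ => g c) hg.weaken hf).congr fun c => by simp

theorem countLT {P : C → ℕ → Prop} {n : C → ℕ} (hP : PolyDec fun p : C × ℕ => P p.1 p.2)
    (hn : PolyDef n) : PolyDef fun c => countLT (P c) (n c) := by
  classical
  refine (sum (f := fun c i => if P c i then 1 else 0) hP hn).congr fun c => ?_
  rw [countLT_eq_card, Finset.card_filter]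

theorem decLt {f g : C → ℕ} (hf : PolyDef f) (hg : PolyDef g) :
    PolyDec fun c => f c < g c := by
  refine (cond (hg.sub hf) (const 1) (const 0)).congr fun c => ?_
  by_cases h : f c < g c
  · simp [h, Nat.sub_ne_zero_of_lt h]
  · simp [h, Nat.sub_eq_zero_of_le (not_lt.1 h)]

end PolyDef

namespace PolyDec

open PolyDef

theorem congr {P Q : C → Prop} (hP : PolyDec P) (h : ∀ c, P c ↔ Q c) : PolyDec Q := by
  rwa [← show P = Q from funext fun c => propext (h c)]

theorem not {P : C → Prop} (hP : PolyDec P) : PolyDec fun c => ¬ P c := by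
  classical
  refine (ite hP (const 0) (const 1)).congr fun c => ?_
  by_cases h : P c <;> simp [h]

theorem and {P Q : C → Prop} (hP : PolyDec P) (hQ : PolyDec Q) : PolyDec fun c => P c ∧ Q c := by
  classical
  refine (ite hP hQ (const 0)).congr fun c => ?_
  by_cases h : P c <;> simp [h]

theorem or {P Q : C → Prop} (hP : PolyDec P) (hQ : PolyDec Q) : PolyDec fun c => P c ∨ Q c := by
  classical
  refine (ite hP (const 1) hQ).congr fun c => ?_
  by_cases h : P c <;> simp [h]

theorem imp {P Q : C → Prop} (hP : PolyDec P) (hQ : PolyDec Q) : PolyDec fun c => P c → Q c :=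
  (hP.not.or hQ).congr fun _ => imp_iff_not_or.symm

theorem iff {P Q : C → Prop} (hP : PolyDec P) (hQ : PolyDec Q) : PolyDec fun c => P c ↔ Q c :=
  ((hP.imp hQ).and (hQ.imp hP)).congr fun _ => iff_def.symm

theorem ite {P Q R : C → Prop} (hP : PolyDec P) (hQ : PolyDec Q) (hR : PolyDec R) :
    PolyDec fun c => open Classical in if P c then Q c else R c :=
  ((hP.and hQ).or (hP.not.and hR)).congr fun c => by by_cases h : P c <;> simp [h]

theorem le {f g : C → ℕ} (hf : PolyDef f) (hg : PolyDef g) : PolyDec fun c => f c ≤ g c :=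
  (hg.decLt hf).not.congr fun _ => not_lt

theorem eq {f g : C → ℕ} (hf : PolyDef f) (hg : PolyDef g) : PolyDec fun c => f c = g c :=
  ((le hf hg).and (le hg hf)).congr fun _ => le_antisymm_iff.symm

theorem exists_lt {P : C → ℕ → Prop} {n : C → ℕ} (hP : PolyDec fun p : C × ℕ => P p.1 p.2)
    (hn : PolyDef n) : PolyDec fun c => ∃ i < n c, P c i := by
  refine ((const 0).decLt (PolyDef.countLT hP hn)).congr fun c => ⟨fun h => ?_, ?_⟩
  · obtain ⟨v, hv, hp, -⟩ := exists_countLT_eq h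
    exact ⟨v, hv, hp⟩
  · rintro ⟨i, hi, hp⟩
    exact (Nat.zero_le _).trans_lt (countLT_lt_of_lt hi hp)

theorem forall_lt {P : C → ℕ → Prop} {n : C → ℕ} (hP : PolyDec fun p : C × ℕ => P p.1 p.2)
    (hn : PolyDef n) : PolyDec fun c => ∀ i < n c, P c i :=
  (exists_lt (P := fun c i => ¬ P c i) hP.not hn).not.congr fun c => by push Not; rfl

end PolyDec

namespace PolyDef

theorem min {f g : C → ℕ} (hf : PolyDef f) (hg : PolyDef g) :
    PolyDef fun c => min (f c) (g c) :=
  (ite (PolyDec.le hf hg) hf hg).congr fun c => by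
    rw [min_def]
    congr

theorem div {f g : C → ℕ} (hf : PolyDef f) (hg : PolyDef g) : PolyDef fun c => f c / g c := by
  refine (ite ((const 0).decLt hg) (countLT (P := fun c q => (q + 1) * g c ≤ f c)
    (PolyDec.le ((last.add (const 1)).mul hg.weaken) hf.weaken) hf) (const 0)).congr fun c => ?_
  split_ifs with h
  · classical
    rw [countLT_eq_card]
    refine (congrArg Finset.card (?_ : _ = Finset.range (f c / g c))).trans
      (Finset.card_range _)
    ext q
    simp only [Finset.mem_filter, Finset.mem_range]
    rw [← Nat.le_div_iff_mul_le h, Nat.succ_le_iff]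
    exact ⟨fun h => h.2, fun h => ⟨h.trans_le (Nat.div_le_self _ _), h⟩⟩
  · rw [Nat.eq_zero_of_not_pos h, Nat.div_zero]

theorem mod {f g : C → ℕ} (hf : PolyDef f) (hg : PolyDef g) : PolyDef fun c => f c % g c :=
  (hf.sub (hg.mul (hf.div hg))).congr fun c => by
    have := Nat.div_add_mod (f c) (g c)
    omega

/-- The power itself may be exponential, so it is never formed; iterated halving stays below `f c`.
-/
theorem div_two_pow {f g : C → ℕ} (hf : PolyDef f) (hg : PolyDef g) :
    PolyDef fun c => f c / 2 ^ g c := by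
  have hval : ∀ c i, recVal f (fun p : (C × ℕ) × ℕ => p.1.2 / 2) c i = f c / 2 ^ i := by
    intro c i
    induction i with
    | zero => simp [recVal]
    | succ i ih =>
      rw [pow_succ, ← Nat.div_div_eq_div_mul, ← ih]
      rfl
  obtain ⟨⟨q, hq⟩, -⟩ := id hf
  refine (recursion hf (last.weaken.div (const 2)) hg ⟨q, fun c i _ => ?_⟩).congr
    fun c => hval c _
  rw [hval]
  exact (Nat.div_le_self _ _).trans (hq c)

end PolyDef

end WordContext

/-! ### Reading an instance off its encoding -/

namespace TwinKernel

open WordContext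

/-- The length of the initial run of ones. -/
noncomputable def wordSize (w : List Bool) : ℕ :=
  countLT (fun i => ∀ j < i + 1, bitAt w j = 1) w.length

/-- The adjacency relation of an encoded graph. -/
def wordAdj (w : List Bool) (u v : ℕ) : Prop :=
  u < wordSize w ∧ v < wordSize w ∧ bitAt w (wordSize w + 1 + (u * wordSize w + v)) = 1

/-- The minimum of the budget and twice the number of vertices. -/
noncomputable def wordBudget (w : List Bool) : ℕ :=
  PolyDef.recVal (fun _ : List Bool => 0)
    (fun p => min (2 * p.1.2 + bitAt p.1.1 (p.1.1.length - (p.2 + 1))) (2 * wordSize p.1.1))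
    w (w.length - (wordSize w + 1 + wordSize w * wordSize w))

/-! ### Definability of the ingredients of the kernel. -/

section Definability

variable {C : Type} [WordContext C] {a b : C → ℕ}

theorem polyDef_wordSize : PolyDef fun c : C => wordSize (word c) :=
  .countLT (P := fun c i => ∀ j < i + 1, bitAt (word c) j = 1)
    (.forall_lt (P := fun p j => bitAt (word p) j = 1)
      (.eq (.bit (C := (C × ℕ) × ℕ) .last) (.const 1)) (.add .last (.const 1))) .wordLength

theorem polyDec_wordAdj (ha : PolyDef a) (hb : PolyDef b) :
    PolyDec fun c => wordAdj (word c) (a c) (b c) :=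
  (ha.decLt polyDef_wordSize).and ((hb.decLt polyDef_wordSize).and
    (.eq (.bit ((polyDef_wordSize.add (.const 1)).add ((ha.mul polyDef_wordSize).add hb)))
      (.const 1)))

/-- Capping at every round keeps the recursion polynomially bounded, although the budget is written
in binary. -/
theorem polyDef_wordBudget : PolyDef wordBudget := by
  refine PolyDef.recursion (.const 0) (.min (.add (.mul (.const 2) (.weaken .last))
    (.bit (C := (List Bool × ℕ) × ℕ)
      (.sub (.wordLength (C := (List Bool × ℕ) × ℕ)) (.add .last (.const 1)))))
    (.mul (.const 2) (polyDef_wordSize (C := (List Bool × ℕ) × ℕ))))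
    (.sub (.wordLength (C := List Bool)) (.add (.add polyDef_wordSize (.const 1))
      (.mul polyDef_wordSize polyDef_wordSize))) ?_
  obtain ⟨⟨q, hq⟩, -⟩ := polyDef_wordSize (C := List Bool)
  refine ⟨2 * q, fun w i _ => ?_⟩
  cases i with
  | zero => exact Nat.zero_le _
  | succ i =>
    refine (min_le_right _ _).trans ?_
    have h : wordSize w ≤ q.eval (size w) := hq w
    simpa using h

theorem polyDec_isTwin (ha : PolyDef a) (hb : PolyDef b) :
    PolyDec fun c => IsTwin (wordAdj (word c)) (wordSize (word c)) (a c) (b c) :=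
  (polyDec_wordAdj ha hb).and (.forall_lt
    (P := fun c w => w ≠ a c → w ≠ b c → (wordAdj (word c) (a c) w ↔ wordAdj (word c) (b c) w))
    (.imp (.not (.eq .last ha.weaken)) (.imp (.not (.eq .last hb.weaken))
      (.iff (polyDec_wordAdj (C := C × ℕ) ha.weaken .last)
        (polyDec_wordAdj (C := C × ℕ) hb.weaken .last)))) polyDef_wordSize)

theorem polyDec_nonTwinEdge (ha : PolyDef a) (hb : PolyDef b) :
    PolyDec fun c => NonTwinEdge (wordAdj (word c)) (wordSize (word c)) (a c) (b c) :=
  (polyDec_wordAdj ha hb).and (polyDec_isTwin ha hb).not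

theorem polyDef_nonTwinDegree (ha : PolyDef a) :
    PolyDef fun c => nonTwinDegree (wordAdj (word c)) (wordSize (word c)) (a c) :=
  .countLT (P := fun c u => NonTwinEdge (wordAdj (word c)) (wordSize (word c)) u (a c))
    (polyDec_nonTwinEdge (C := C × ℕ) .last ha.weaken) polyDef_wordSize

theorem polyDec_inCover (ha : PolyDef a) (hb : PolyDef b) :
    PolyDec fun c => InCover (wordAdj (word c)) (wordSize (word c)) (a c) (b c) :=
  (ha.decLt (polyDef_nonTwinDegree hb)).or (.exists_lt
    (P := fun c u => nonTwinDegree (wordAdj (word c)) (wordSize (word c)) u ≤ a c ∧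
      NonTwinEdge (wordAdj (word c)) (wordSize (word c)) u (b c))
    (.and (.le (polyDef_nonTwinDegree (C := C × ℕ) .last) ha.weaken)
      (polyDec_nonTwinEdge (C := C × ℕ) .last hb.weaken)) polyDef_wordSize)

theorem polyDef_coverSize (ha : PolyDef a) :
    PolyDef fun c => coverSize (wordAdj (word c)) (wordSize (word c)) (a c) :=
  .countLT (P := fun c => InCover (wordAdj (word c)) (wordSize (word c)) (a c))
    (polyDec_inCover (C := C × ℕ) ha.weaken .last) polyDef_wordSize

theorem polyDef_threshold :
    PolyDef fun c : C => threshold (wordAdj (word c)) (wordSize (word c)) :=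
  .countLT (P := fun c t => ∀ t' < t + 1,
      ¬ coverSize (wordAdj (word c)) (wordSize (word c)) t' ≤ t' * t' + t')
    (.forall_lt (P := fun c t' =>
        ¬ coverSize (wordAdj (word c)) (wordSize (word c)) t' ≤ t' * t' + t')
      (.not (.le (polyDef_coverSize (C := (C × ℕ) × ℕ) .last)
        (.add (.mul .last .last) .last))) (.add .last (.const 1))) polyDef_wordSize

theorem polyDec_core (ha : PolyDef a) :
    PolyDec fun c => Core (wordAdj (word c)) (wordSize (word c)) (a c) :=
  polyDec_inCover polyDef_threshold ha

theorem polyDef_coreSize :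
    PolyDef fun c : C => coreSize (wordAdj (word c)) (wordSize (word c)) :=
  polyDef_coverSize polyDef_threshold

theorem polyDef_twinRank (ha : PolyDef a) :
    PolyDef fun c => twinRank (wordAdj (word c)) (wordSize (word c)) (a c) :=
  .countLT (P := fun c u => IsTwin (wordAdj (word c)) (wordSize (word c)) u (a c))
    (polyDec_isTwin (C := C × ℕ) .last ha.weaken) ha

variable (k : ℕ)

theorem polyDef_surplus :
    PolyDef fun c : C => surplus (wordAdj (word c)) (wordSize (word c)) k :=
  .countLT (P := fun c v => k ≤ twinRank (wordAdj (word c)) (wordSize (word c)) v)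
    (.le (.const k) (polyDef_twinRank (C := C × ℕ) .last)) polyDef_wordSize

theorem polyDec_isFull (ha : PolyDef a) :
    PolyDec fun c => IsFull (wordAdj (word c)) (wordSize (word c)) k (a c) :=
  .exists_lt (P := fun c u => (u = a c ∨ IsTwin (wordAdj (word c)) (wordSize (word c)) u (a c)) ∧
      twinRank (wordAdj (word c)) (wordSize (word c)) u + 1 = k)
    (.and (.or (.eq .last ha.weaken) (polyDec_isTwin (C := C × ℕ) .last ha.weaken))
      (.eq (.add (polyDef_twinRank (C := C × ℕ) .last) (.const 1)) (.const k)))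
    polyDef_wordSize

theorem polyDec_isRep (ha : PolyDef a) :
    PolyDec fun c => IsRep (wordAdj (word c)) (wordSize (word c)) (a c) :=
  .and (polyDec_core ha).not (.eq (polyDef_twinRank ha) (.const 0))

theorem polyDec_isSimilar {s t : C → ℕ} (hs : PolyDef s) (ht : PolyDef t) (ha : PolyDef a)
    (hb : PolyDef b) : PolyDec fun c =>
      IsSimilar (wordAdj (word c)) (wordSize (word c)) k (s c) (t c) (a c) (b c) :=
  .and (polyDec_isRep hb) (.and (.iff (polyDec_isFull k hb) (polyDec_isFull k ha))
    (.and (polyDec_wordAdj hs hb) (polyDec_wordAdj ht hb)))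

theorem polyDec_isMarked (ha : PolyDef a) :
    PolyDec fun c => IsMarked (wordAdj (word c)) (wordSize (word c)) k (a c) := by
  refine .and (polyDec_isRep ha) (.exists_lt (P := fun c s => ∃ t < wordSize (word c),
    Core (wordAdj (word c)) (wordSize (word c)) s ∧
      Core (wordAdj (word c)) (wordSize (word c)) t ∧
      wordAdj (word c) s (a c) ∧ wordAdj (word c) t (a c) ∧
      countLT (IsSimilar (wordAdj (word c)) (wordSize (word c)) k s t (a c)) (a c) ≤
        coreSize (wordAdj (word c)) (wordSize (word c))) ?_ polyDef_wordSize)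
  refine .exists_lt (P := fun (p : C × ℕ) t => Core (wordAdj (word p)) (wordSize (word p)) p.2 ∧
      Core (wordAdj (word p)) (wordSize (word p)) t ∧
      wordAdj (word p) p.2 (a p.1) ∧ wordAdj (word p) t (a p.1) ∧
      countLT (IsSimilar (wordAdj (word p)) (wordSize (word p)) k p.2 t (a p.1)) (a p.1) ≤
        coreSize (wordAdj (word p)) (wordSize (word p))) ?_ (polyDef_wordSize (C := C × ℕ))
  refine .and (polyDec_core (C := (C × ℕ) × ℕ) (.weaken .last))
    (.and (polyDec_core (C := (C × ℕ) × ℕ) .last)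
    (.and (polyDec_wordAdj (C := (C × ℕ) × ℕ) (.weaken .last) ha.weaken.weaken)
    (.and (polyDec_wordAdj (C := (C × ℕ) × ℕ) .last ha.weaken.weaken)
    (.le ?_ (polyDef_coreSize (C := (C × ℕ) × ℕ))))))
  exact .countLT (P := fun (p : (C × ℕ) × ℕ) => IsSimilar (wordAdj (word p)) (wordSize (word p)) k
      p.1.2 p.2 (a p.1.1))
    (polyDec_isSimilar (C := ((C × ℕ) × ℕ) × ℕ) k (.weaken (.weaken .last)) (.weaken .last)
      ha.weaken.weaken.weaken .last) ha.weaken.weaken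

theorem polyDec_isKept (ha : PolyDef a) :
    PolyDec fun c => IsKept (wordAdj (word c)) (wordSize (word c)) k (a c) :=
  .and (ha.decLt polyDef_wordSize) (.and ((polyDef_twinRank ha).decLt (.const k))
    (.or (polyDec_core ha) (.exists_lt
      (P := fun c w => (w = a c ∨ IsTwin (wordAdj (word c)) (wordSize (word c)) w (a c)) ∧
        IsMarked (wordAdj (word c)) (wordSize (word c)) k w)
      (.and (.or (.eq .last ha.weaken) (polyDec_isTwin (C := C × ℕ) .last ha.weaken))
        (polyDec_isMarked (C := C × ℕ) k .last)) polyDef_wordSize)))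

end Definability

end TwinKernel

/-! ### The bits of an encoded instance -/

/-- The binary digits of a number, least significant first. -/
def binaryDigits (k : ℕ) : List Bool :=
  (List.range (Nat.size k)).map fun m => decide (k / 2 ^ m % 2 ≠ 0)

theorem binaryDigits_two_mul {k : ℕ} (hk : k ≠ 0) :
    binaryDigits (2 * k) = false :: binaryDigits k := by
  have hs : Nat.size (2 * k) = Nat.size k + 1 := by
    have := Nat.size_bit (b := false) (n := k) (by simpa using hk)
    simpa using this
  rw [binaryDigits, hs, List.range_succ_eq_map, List.map_cons, List.map_map]
  congr 1
  · simp
  · refine List.map_congr_left fun m _ => ?_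
    simp only [Function.comp_apply, Nat.succ_eq_add_one, pow_succ']
    rw [← Nat.div_div_eq_div_mul, Nat.mul_div_cancel_left _ (by omega)]

theorem binaryDigits_two_mul_add_one (k : ℕ) :
    binaryDigits (2 * k + 1) = true :: binaryDigits k := by
  have hs : Nat.size (2 * k + 1) = Nat.size k + 1 := by
    have := Nat.size_bit (b := true) (n := k) (by simp)
    simpa using this
  rw [binaryDigits, hs, List.range_succ_eq_map, List.map_cons, List.map_map]
  congr 1
  · simp [Nat.add_mod]
  · refine List.map_congr_left fun m _ => ?_
    simp only [Function.comp_apply, Nat.succ_eq_add_one, pow_succ']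
    rw [← Nat.div_div_eq_div_mul, show (2 * k + 1) / 2 = k by omega]

theorem encodePosNum_eq (p : PosNum) : Computability.encodePosNum p = binaryDigits (p : ℕ) := by
  induction p with
  | one =>
    rw [PosNum.cast_one', show (1 : ℕ) = 2 * 0 + 1 from rfl, binaryDigits_two_mul_add_one]
    rfl
  | bit0 p ih =>
    rw [Computability.encodePosNum, ih, PosNum.cast_bit0, ← two_mul,
      binaryDigits_two_mul p.cast_pos.ne']
  | bit1 p ih =>
    rw [Computability.encodePosNum, ih, PosNum.cast_bit1, ← two_mul,
      binaryDigits_two_mul_add_one]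

/-- This closed form makes each digit accessible through `PolyDef.div_two_pow`. -/
theorem encodeNat_eq (k : ℕ) : Computability.encodeNat k = binaryDigits k := by
  rw [Computability.encodeNat]
  conv_rhs => rw [← Num.to_of_nat k]
  generalize (k : Num) = m
  cases m with
  | zero => rfl
  | pos p => exact encodePosNum_eq p

/-- The number with given binary digits. -/
def binaryValue (l : List Bool) : ℕ := l.foldr (fun b v => 2 * v + b.toNat) 0

theorem binaryValue_binaryDigits (k : ℕ) : binaryValue (binaryDigits k) = k := by
  induction k using Nat.strong_induction_on with
  | _ k ih =>
    rcases Nat.eq_zero_or_pos k with rfl | hk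
    · rfl
    rcases Nat.even_or_odd' k with ⟨m, rfl | rfl⟩
    · rw [binaryDigits_two_mul (by omega)]
      change 2 * binaryValue (binaryDigits m) + 0 = _
      rw [ih m (by omega)]
      rfl
    · rw [binaryDigits_two_mul_add_one]
      change 2 * binaryValue (binaryDigits m) + 1 = _
      rw [ih m (by omega)]

/-- A quotient by `2 ^ m` is non-zero exactly for `m` below the binary length, which makes this
length definable by counting. -/
theorem countLT_div_two_pow (k : ℕ) : countLT (fun m => k / 2 ^ m ≠ 0) k = Nat.size k := by
  classical
  have h : ∀ m, k / 2 ^ m ≠ 0 ↔ m < Nat.size k := fun m => by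
    rw [Nat.lt_size, Nat.div_ne_zero_iff]
    simp
  have hs : Nat.size k ≤ k := Nat.size_le.2 Nat.lt_two_pow_self
  rw [countLT_congr fun m _ => h m, countLT_eq_card]
  refine (congrArg Finset.card (?_ : _ = Finset.range (Nat.size k))).trans (Finset.card_range _)
  ext m
  simp only [Finset.mem_filter, Finset.mem_range]
  omega

theorem flatMap_range_eq (m n : ℕ) (f : ℕ → ℕ → Bool) :
    ((List.range m).flatMap fun i => (List.range n).map (f i)) =
      (List.range (m * n)).map fun j => f (j / n) (j % n) := by
  induction m with
  | zero => simp
  | succ m ih =>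
    rw [List.range_succ, List.flatMap_append, ih, Nat.succ_mul, List.range_add, List.map_append,
      List.map_map]
    congr 1
    simp only [List.flatMap_cons, List.flatMap_nil, List.append_nil]
    refine List.map_congr_left fun j hj => ?_
    have hj : j < n := List.mem_range.1 hj
    simp only [Function.comp_apply]
    rw [Nat.mul_comm, Nat.mul_add_mod, Nat.mod_eq_of_lt hj, Nat.mul_add_div (by omega),
      Nat.div_eq_of_lt hj, Nat.add_zero]

open Classical in
theorem adjacencyBits_eq {n : ℕ} (G : SimpleGraph (Fin n)) (R : ℕ → ℕ → Prop)
    (hR : ∀ i j : Fin n, G.Adj i j ↔ R i j) :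
    adjacencyBits G = (List.range (n * n)).map fun j => decide (R (j / n) (j % n)) := by
  rw [← flatMap_range_eq n n fun i j => decide (R i j), adjacencyBits, ← List.map_coe_finRange_eq_range,
    List.flatMap_map]
  refine List.flatMap_congr fun i _ => ?_
  rw [List.map_map]
  refine List.map_congr_left fun j _ => ?_
  simp [hR]

/-- The bits of an encoded graph with `n` vertices, adjacency relation `R` and budget `k`. -/
noncomputable def instanceBit (n : ℕ) (R : ℕ → ℕ → Prop) (k i : ℕ) : ℕ :=
  open Classical in
  if i < n then 1 else if i < n + 1 then 0 else
    if i < n + 1 + n * n then (if R ((i - (n + 1)) / n) ((i - (n + 1)) % n) then 1 else 0)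
    else k / 2 ^ (i - (n + 1 + n * n)) % 2

/-- The length of an encoded graph with `n` vertices and budget `k`. -/
noncomputable def instanceLength (n k : ℕ) : ℕ :=
  n + 1 + n * n + countLT (fun m => k / 2 ^ m ≠ 0) k

theorem GraphBudget.encode_eq (y : GraphBudget) (R : ℕ → ℕ → Prop)
    (hR : ∀ i j : Fin y.n, y.graph.Adj i j ↔ R i j) :
    y.encode = (List.range (instanceLength y.n y.budget)).map fun i =>
      decide (instanceBit y.n R y.budget i ≠ 0) := by
  classical
  rw [instanceLength, countLT_div_two_pow, List.range_add, List.range_add, List.range_add,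
    List.map_append, List.map_append, List.map_append, GraphBudget.encode,
    adjacencyBits_eq y.graph R hR, encodeNat_eq, List.append_assoc, List.append_assoc]
  have h1 : List.replicate y.n true = (List.range y.n).map fun i =>
      decide (instanceBit y.n R y.budget i ≠ 0) := by
    refine List.ext_getElem (by simp) fun i h1 h2 => ?_
    have : i < y.n := by simpa using h1
    simp [instanceBit, this]
  have h2 : [false] = ((List.range 1).map (y.n + ·)).map fun i =>
      decide (instanceBit y.n R y.budget i ≠ 0) := by
    simp [instanceBit]
  have h3 : ((List.range (y.n * y.n)).map fun j => decide (R (j / y.n) (j % y.n))) =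
      ((List.range (y.n * y.n)).map (y.n + 1 + ·)).map fun i =>
        decide (instanceBit y.n R y.budget i ≠ 0) := by
    rw [List.map_map]
    refine List.map_congr_left fun j hj => ?_
    have hj : j < y.n * y.n := List.mem_range.1 hj
    have h1 : ¬ y.n + 1 + j < y.n := by omega
    have h2 : ¬ y.n + 1 + j < y.n + 1 := by omega
    have h3 : y.n + 1 + j < y.n + 1 + y.n * y.n := by omega
    have h4 : y.n + 1 + j - (y.n + 1) = j := by omega
    simp only [Function.comp_apply, instanceBit, if_neg h1, if_neg h2, if_pos h3, h4]
    by_cases h : R (j / y.n) (j % y.n) <;> simp [h]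
  have h4 : binaryDigits y.budget =
      ((List.range (Nat.size y.budget)).map (y.n + 1 + y.n * y.n + ·)).map fun i =>
        decide (instanceBit y.n R y.budget i ≠ 0) := by
    rw [List.map_map, binaryDigits]
    refine List.map_congr_left fun j _ => ?_
    have h1 : ¬ y.n + 1 + y.n * y.n + j < y.n := by omega
    have h2 : ¬ y.n + 1 + y.n * y.n + j < y.n + 1 := by omega
    have h3 : ¬ y.n + 1 + y.n * y.n + j < y.n + 1 + y.n * y.n := by omega
    have h4 : y.n + 1 + y.n * y.n + j - (y.n + 1 + y.n * y.n) = j := by omega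
    simp only [Function.comp_apply, instanceBit, if_neg h1, if_neg h2, if_neg h3, h4]
  rw [← h1, ← h2, ← h3, ← h4]
  rfl

open WordContext in
/-- A map between instances is computable in polynomial time if the number of vertices, the
adjacency relation and the budget of the result are definable. -/
theorem GraphBudget.tm2ComputableInPolyTime {f : GraphBudget → GraphBudget}
    {N K : List Bool → ℕ} {R : List Bool → ℕ → ℕ → Prop} (hN : PolyDef N) (hK : PolyDef K)
    (hR : PolyDec fun p : (List Bool × ℕ) × ℕ => R p.1.1 p.1.2 p.2)
    (hfN : ∀ x, (f x).n = N x.encode) (hfK : ∀ x, (f x).budget = K x.encode)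
    (hfR : ∀ x (i j : Fin (f x).n), (f x).graph.Adj i j ↔ R x.encode i j) :
    Nonempty (Turing.TM2ComputableInPolyTime GraphBudget.encode GraphBudget.encode f) := by
  refine PolyDef.tm2ComputableInPolyTime (L := fun w => instanceLength (N w) (K w))
    (B := fun p => instanceBit (N p.1) (R p.1) (K p.1) p.2) ?_ ?_ fun x => ?_
  · exact .add (.add (.add hN (.const 1)) (.mul hN hN))
      (.countLT (P := fun w m => K w / 2 ^ m ≠ 0)
        (.not (.eq (.div_two_pow hK.weaken .last) (.const 0))) hK)
  · have hi : PolyDef fun p : List Bool × ℕ => p.2 := .last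
    have hN1 : PolyDef fun p : List Bool × ℕ => N p.1 + 1 := .add hN.weaken (.const 1)
    have hN2 := hN1.add (hN.weaken.mul hN.weaken)
    have hR' : PolyDec fun p : List Bool × ℕ =>
        R p.1 ((p.2 - (N p.1 + 1)) / N p.1) ((p.2 - (N p.1 + 1)) % N p.1) := by
      have e1 := (hi.sub hN1).div hN.weaken
      have e2 := (hi.sub hN1).mod hN.weaken
      have h1 : PolyDec fun p : ((List Bool × ℕ) × ℕ) × ℕ => R p.1.1.1 p.1.2 p.2 :=
        PolyDef.rename hR (fun p : ((List Bool × ℕ) × ℕ) × ℕ => ((p.1.1.1, p.1.2), p.2)) (Fin.cons 0 (Fin.cons 1 Fin.elim0))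
          (fun _ => rfl) fun _ => Fin.cases rfl (Fin.cases rfl fun j => j.elim0)
      -- The row and column of the matrix entry are substituted for the two added variables.
      exact PolyDef.bind (PolyDef.bind h1 e2.weaken) e1
    refine PolyDef.congr (.ite (hi.decLt hN.weaken) (.const 1) (.ite (hi.decLt hN1) (.const 0)
      (.ite (hi.decLt hN2) (.ite hR' (.const 1) (.const 0))
        ((PolyDef.div_two_pow hK.weaken (hi.sub hN2)).mod (.const 2))))) fun p => ?_
    rw [instanceBit]
    split_ifs <;> rfl
  · rw [GraphBudget.encode_eq (f x) (R x.encode) (hfR x), hfN, hfK]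

namespace TwinKernel

open WordContext

/-! ### Reading off the encoding -/

/-- Adjacency of vertices, given as natural numbers. -/
def adjNat (x : GraphBudget) (u v : ℕ) : Prop :=
  ∃ (hu : u < x.n) (hv : v < x.n), x.graph.Adj ⟨u, hu⟩ ⟨v, hv⟩

theorem isGraphOn_adjNat (x : GraphBudget) : IsGraphOn (adjNat x) x.n where
  symm := fun ⟨hu, hv, h⟩ => ⟨hv, hu, h.symm⟩
  irrefl := fun _ ⟨_, _, h⟩ => x.graph.irrefl h
  lt := fun ⟨hu, _, _⟩ => hu

theorem encode_eq_instanceBit (x : GraphBudget) :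
    x.encode = (List.range (instanceLength x.n x.budget)).map fun i =>
      decide (instanceBit x.n (adjNat x) x.budget i ≠ 0) :=
  x.encode_eq (adjNat x) fun i j => ⟨fun h => ⟨i.2, j.2, h⟩, fun ⟨_, _, h⟩ => h⟩

theorem length_encode (x : GraphBudget) :
    x.encode.length = x.n + 1 + x.n * x.n + Nat.size x.budget := by
  rw [encode_eq_instanceBit, List.length_map, List.length_range, instanceLength,
    countLT_div_two_pow]

theorem bitAt_encode (x : GraphBudget) {i : ℕ} (hi : i < x.encode.length) :
    bitAt x.encode i = 1 ↔ instanceBit x.n (adjNat x) x.budget i ≠ 0 := by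
  have h : i < instanceLength x.n x.budget := by
    rwa [length_encode, ← countLT_div_two_pow] at hi
  rw [encode_eq_instanceBit]
  simp [bitAt, h]

theorem wordSize_encode (x : GraphBudget) : wordSize x.encode = x.n := by
  classical
  have hlen := length_encode x
  have h1 : ∀ i < x.n, bitAt x.encode i = 1 := fun i hi =>
    (bitAt_encode x (by omega)).2 (by simp [instanceBit, hi])
  have h2 : ¬ bitAt x.encode x.n = 1 := by
    rw [bitAt_encode x (by omega)]
    simp [instanceBit]
  rw [wordSize, countLT_eq_card]
  refine (congrArg Finset.card (?_ : _ = Finset.range x.n)).trans (Finset.card_range _)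
  ext i
  simp only [Finset.mem_filter, Finset.mem_range]
  constructor
  · rintro ⟨-, h⟩
    by_contra hc
    exact h2 (h _ (by omega))
  · intro h
    exact ⟨by omega, fun j hj => h1 j (by omega)⟩

theorem wordAdj_encode (x : GraphBudget) (u v : ℕ) : wordAdj x.encode u v ↔ adjNat x u v := by
  rw [wordAdj, wordSize_encode]
  constructor
  · rintro ⟨hu, hv, h⟩
    have hlt : u * x.n + v < x.n * x.n := by
      have := Nat.mul_le_mul_right x.n (Nat.succ_le_of_lt hu)
      rw [Nat.succ_mul] at this
      omega
    have hlen := length_encode x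
    rw [bitAt_encode x (by omega), instanceBit, if_neg (by omega), if_neg (by omega),
      if_pos (by omega), Nat.add_sub_cancel_left, Nat.mul_comm, Nat.mul_add_mod,
      Nat.mod_eq_of_lt hv, Nat.mul_add_div (by omega), Nat.div_eq_of_lt hv, Nat.add_zero] at h
    by_contra hc
    simp [hc] at h
  · rintro ⟨hu, hv, h⟩
    refine ⟨hu, hv, ?_⟩
    have hlt : u * x.n + v < x.n * x.n := by
      have := Nat.mul_le_mul_right x.n (Nat.succ_le_of_lt hu)
      rw [Nat.succ_mul] at this
      omega
    have hlen := length_encode x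
    rw [bitAt_encode x (by omega), instanceBit, if_neg (by omega), if_neg (by omega),
      if_pos (by omega), Nat.add_sub_cancel_left, Nat.mul_comm, Nat.mul_add_mod,
      Nat.mod_eq_of_lt hv, Nat.mul_add_div (by omega), Nat.div_eq_of_lt hv, Nat.add_zero,
      if_pos ⟨hu, hv, h⟩]
    exact one_ne_zero

theorem wordAdj_encode_eq (x : GraphBudget) : wordAdj x.encode = adjNat x :=
  funext fun u => funext fun v => propext (wordAdj_encode x u v)

/-- The digits are read from the most significant one. Capping commutes with `v ↦ 2 * v + b`,
because once `v` reaches the cap so does its successor value. -/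
theorem wordBudget_encode (x : GraphBudget) : wordBudget x.encode = min x.budget (2 * x.n) := by
  set l := binaryDigits x.budget with hl
  have hlen := length_encode x
  have hll : l.length = Nat.size x.budget := by simp [hl, binaryDigits]
  have hbit : ∀ m (hm : m < l.length),
      bitAt x.encode (x.n + 1 + x.n * x.n + m) = l[m].toNat := by
    intro m hm
    have h1 := bitAt_encode x (i := x.n + 1 + x.n * x.n + m) (by omega)
    rw [instanceBit, if_neg (by omega), if_neg (by omega), if_neg (by omega),
      Nat.add_sub_cancel_left] at h1
    have h2 : l[m] = decide (x.budget / 2 ^ m % 2 ≠ 0) := by simp [hl, binaryDigits]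
    rw [h2]
    by_cases h : x.budget / 2 ^ m % 2 = 0
    · rw [decide_eq_false (by simpa using h)]
      have h3 : ¬ bitAt x.encode (x.n + 1 + x.n * x.n + m) = 1 := fun h' => h1.1 h' h
      simp only [bitAt] at h3 ⊢
      split_ifs at h3 ⊢
      · exact absurd rfl h3
      · rfl
    · rw [decide_eq_true h, h1.2 h]
      rfl
  have main : ∀ i ≤ l.length, PolyDef.recVal (fun _ : List Bool => 0)
      (fun p => min (2 * p.1.2 + bitAt p.1.1 (p.1.1.length - (p.2 + 1))) (2 * wordSize p.1.1))
      x.encode i = min (binaryValue (l.drop (l.length - i))) (2 * x.n) := by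
    intro i hi
    induction i with
    | zero => simp [PolyDef.recVal, binaryValue]
    | succ i ih =>
      have hlt : l.length - (i + 1) < l.length := by omega
      rw [PolyDef.recVal, ih (by omega), List.drop_eq_getElem_cons hlt,
        show l.length - (i + 1) + 1 = l.length - i by omega]
      dsimp only
      rw [wordSize_encode, show x.encode.length - (i + 1) =
        x.n + 1 + x.n * x.n + (l.length - (i + 1)) by omega, hbit _ hlt]
      change _ = min (2 * binaryValue (l.drop (l.length - i)) + l[l.length - (i + 1)].toNat) _
      omega
  rw [wordBudget, wordSize_encode,
    show x.encode.length - (x.n + 1 + x.n * x.n) = l.length by omega, main _ le_rfl,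
    Nat.sub_self, List.drop_zero, hl, binaryValue_binaryDigits]

/-! ### The kernel as a map between instances -/

section Kernel

variable (c : ℕ)

/-- The instance is recognized as a no-instance since there are too many twins. -/
def Rejects (w : List Bool) : Prop := wordBudget w < surplus (wordAdj w) (wordSize w) c

/-- The number of vertices of the kernel. -/
noncomputable def kernelSize (w : List Bool) : ℕ :=
  open Classical in
  -- The rejecting output is a triangle with budget `0`, a no-instance for one and for two colours.
  if Rejects c w then 3 else countLT (IsKept (wordAdj w) (wordSize w) c) (wordSize w)

/-- The budget of the kernel. -/
noncomputable def kernelBudget (w : List Bool) : ℕ :=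
  open Classical in
  if Rejects c w then 0 else
    min (wordBudget w - surplus (wordAdj w) (wordSize w) c) (coreSize (wordAdj w) (wordSize w))

/-- The `i`-th vertex below `n` with property `P`. -/
noncomputable def nthVertex (P : ℕ → Prop) (n i : ℕ) : ℕ :=
  -- With indices starting at `0`, the numbers counted are those before the sought vertex.
  countLT (fun v => countLT P (v + 1) ≤ i) n

/-- The adjacency relation of the kernel. -/
def KernelAdj (w : List Bool) (i j : ℕ) : Prop :=
  open Classical in
  if Rejects c w then i ≠ j else
    wordAdj w (nthVertex (IsKept (wordAdj w) (wordSize w) c) (wordSize w) i)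
      (nthVertex (IsKept (wordAdj w) (wordSize w) c) (wordSize w) j)

/-- The kernel. -/
noncomputable def kernel (x : GraphBudget) : GraphBudget where
  n := kernelSize c x.encode
  graph :=
    { Adj := fun i j => KernelAdj c x.encode i j
      symm := ⟨fun i j h => by
        rw [KernelAdj] at h ⊢
        split_ifs at h ⊢
        · exact h.symm
        · rw [wordAdj_encode_eq] at h ⊢
          exact (isGraphOn_adjNat x).symm h⟩
      loopless := ⟨fun i h => by
        rw [KernelAdj] at h
        split_ifs at h
        · exact h rfl
        · rw [wordAdj_encode_eq] at h
          exact (isGraphOn_adjNat x).irrefl _ h⟩ }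
  budget := kernelBudget c x.encode

theorem kernel_tm2ComputableInPolyTime :
    Nonempty (Turing.TM2ComputableInPolyTime GraphBudget.encode GraphBudget.encode (kernel c)) := by
  have hrej : PolyDec fun w : List Bool => Rejects c w :=
    polyDef_wordBudget.decLt (polyDef_surplus (C := List Bool) c)
  have hnth : ∀ {C : Type} [WordContext C] {a : C → ℕ}, PolyDef a → PolyDef fun p : C =>
      nthVertex (IsKept (wordAdj (word p)) (wordSize (word p)) c) (wordSize (word p)) (a p) := by
    intro C _ a ha
    refine .countLT (P := fun p v =>
      countLT (IsKept (wordAdj (word p)) (wordSize (word p)) c) (v + 1) ≤ a p)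
      (.le (.countLT (P := fun p : C × ℕ => IsKept (wordAdj (word p)) (wordSize (word p)) c)
        (polyDec_isKept (C := (C × ℕ) × ℕ) c .last) (.add .last (.const 1))) ha.weaken)
      polyDef_wordSize
  refine GraphBudget.tm2ComputableInPolyTime (N := kernelSize c) (K := kernelBudget c)
    (R := KernelAdj c) ?_ ?_ ?_ (fun _ => rfl) (fun _ => rfl) fun _ _ _ => Iff.rfl
  · exact .ite hrej (.const 3) (.countLT
      (P := fun w : List Bool => IsKept (wordAdj (word w)) (wordSize (word w)) c)
      (polyDec_isKept (C := List Bool × ℕ) c .last) polyDef_wordSize)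
  · exact .ite hrej (.const 0) (.min (.sub polyDef_wordBudget
      (polyDef_surplus (C := List Bool) c)) (polyDef_coreSize (C := List Bool)))
  · exact .ite (PolyDef.weaken (PolyDef.weaken hrej))
      (.not (.eq (.weaken .last) .last))
      (polyDec_wordAdj (C := (List Bool × ℕ) × ℕ)
        (hnth (C := (List Bool × ℕ) × ℕ) (.weaken .last)) (hnth (C := (List Bool × ℕ) × ℕ) .last))

end Kernel

end TwinKernel

namespace TwinKernel

/-! ### Correctness -/

theorem nthVertex_countLT {P : ℕ → Prop} {n v : ℕ} (hv : v < n) (hP : P v) :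
    nthVertex P n (countLT P v) = v := by
  classical
  rw [nthVertex, countLT_eq_card]
  refine (congrArg Finset.card (?_ : _ = Finset.range v)).trans (Finset.card_range _)
  ext u
  simp only [Finset.mem_filter, Finset.mem_range]
  constructor
  · rintro ⟨-, h⟩
    by_contra hc
    have := countLT_mono P (show v + 1 ≤ u + 1 by omega)
    rw [countLT_succ_of_pos hP] at this
    omega
  · intro h
    exact ⟨by omega, countLT_mono P (by omega)⟩

theorem nthVertex_spec {P : ℕ → Prop} {n i : ℕ} (hi : i < countLT P n) :
    P (nthVertex P n i) ∧ countLT P (nthVertex P n i) = i := by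
  obtain ⟨v, hv, hP, rfl⟩ := exists_countLT_eq hi
  rw [nthVertex_countLT hv hP]
  exact ⟨hP, rfl⟩

/-- The maps `nthVertex P n` and `countLT P` are mutually inverse between the indices and the
vertices below `n` with property `P`, and `B` is `A` transported along them. -/
theorem deletionColorable_nthVertex {A B : ℕ → ℕ → Prop} {P : ℕ → Prop} {n c k : ℕ}
    (hA : IsGraphOn A n)
    (hB : ∀ i j, B i j ↔ i < countLT P n ∧ j < countLT P n ∧
      A (nthVertex P n i) (nthVertex P n j)) :
    DeletionColorable B c (fun _ => True) k ↔ DeletionColorable A c P k := by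
  classical
  constructor
  · rintro ⟨X, hX, col, hcol, h⟩
    refine ⟨X.image (nthVertex P n), Finset.card_image_le.trans hX,
      fun v => col (countLT P v), fun v => hcol _, fun u v huv hu hv huX hvX => ?_⟩
    have hun := hA.lt huv
    have hvn := hA.lt (hA.symm huv)
    refine h _ _ ?_ trivial trivial (fun hc => huX ?_) fun hc => hvX ?_
    · rw [hB, nthVertex_countLT hun hu, nthVertex_countLT hvn hv]
      exact ⟨countLT_lt_of_lt hun hu, countLT_lt_of_lt hvn hv, huv⟩
    · exact Finset.mem_image.2 ⟨_, hc, nthVertex_countLT hun hu⟩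
    · exact Finset.mem_image.2 ⟨_, hc, nthVertex_countLT hvn hv⟩
  · rintro ⟨X, hX, col, hcol, h⟩
    refine ⟨(Finset.range (countLT P n)).filter fun i => nthVertex P n i ∈ X, le_trans ?_ hX,
      fun i => col (nthVertex P n i), fun v => hcol _, fun i j hij _ _ hi hj => ?_⟩
    · refine Finset.card_le_card_of_injOn (nthVertex P n)
        (fun i hi => (Finset.mem_filter.1 (Finset.mem_coe.1 hi)).2) fun i hi j hj he => ?_
      have hi := Finset.mem_range.1 (Finset.mem_filter.1 (Finset.mem_coe.1 hi)).1
      have hj := Finset.mem_range.1 (Finset.mem_filter.1 (Finset.mem_coe.1 hj)).1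
      rw [← (nthVertex_spec hi).2, ← (nthVertex_spec hj).2, he]
    · obtain ⟨hi', hj', hA'⟩ := (hB i j).1 hij
      exact h _ _ hA' (nthVertex_spec hi').1 (nthVertex_spec hj').1
        (fun hc => hi (Finset.mem_filter.2 ⟨Finset.mem_range.2 hi', hc⟩))
        fun hc => hj (Finset.mem_filter.2 ⟨Finset.mem_range.2 hj', hc⟩)

theorem rejects_encode (c : ℕ) (x : GraphBudget) :
    Rejects c x.encode ↔ x.budget < surplus (adjNat x) x.n c := by
  have : surplus (adjNat x) x.n c ≤ x.n := countLT_le _ _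
  rw [Rejects, wordBudget_encode, wordAdj_encode_eq, wordSize_encode]
  omega

theorem deletionColorable_kernel {c : ℕ} (hc : c = 1 ∨ c = 2) (x : GraphBudget) :
    DeletionColorable (adjNat x) c (fun _ => True) x.budget ↔
      DeletionColorable (adjNat (kernel c x)) c (fun _ => True) (kernel c x).budget := by
  have hA := isGraphOn_adjNat x
  rw [deletionColorable_iff hA hc]
  by_cases hr : Rejects c x.encode
  · have hn : (kernel c x).n = 3 := if_pos hr
    have hk : (kernel c x).budget = 0 := if_pos hr
    refine iff_of_false (fun h => ?_) ?_
    · exact absurd h.1 (not_le.2 ((rejects_encode c x).1 hr))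
    · rintro ⟨X, hX, col, hcol, h⟩
      rw [hk, Nat.le_zero, Finset.card_eq_zero] at hX
      subst hX
      have hadj : ∀ i j, i < 3 → j < 3 → i ≠ j → col i ≠ col j := by
        intro i j hi hj hij
        refine h i j ⟨hn ▸ hi, hn ▸ hj, ?_⟩ trivial trivial (Finset.notMem_empty _)
          (Finset.notMem_empty _)
        change KernelAdj c x.encode i j
        rw [KernelAdj, if_pos hr]
        exact hij
      have h1 := hadj 0 1 (by omega) (by omega) (by omega)
      have h2 := hadj 0 2 (by omega) (by omega) (by omega)
      have h3 := hadj 1 2 (by omega) (by omega) (by omega)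
      have h4 := hcol 0
      have h5 := hcol 1
      have h6 := hcol 2
      omega
  · have hs : surplus (adjNat x) x.n c ≤ x.budget :=
      not_lt.1 fun h => hr ((rejects_encode c x).2 h)
    have hn : (kernel c x).n = countLT (IsKept (adjNat x) x.n c) x.n := by
      change kernelSize c x.encode = _
      rw [kernelSize, if_neg hr, wordAdj_encode_eq, wordSize_encode]
    have hk : (kernel c x).budget =
        min (x.budget - surplus (adjNat x) x.n c) (coreSize (adjNat x) x.n) := by
      change kernelBudget c x.encode = _
      rw [kernelBudget, if_neg hr, wordAdj_encode_eq, wordSize_encode, wordBudget_encode]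
      -- Both quantities are at most `n`, so the cap of `2 * n` on the budget does not affect the
      -- minimum.
      have h1 : surplus (adjNat x) x.n c ≤ x.n := countLT_le _ _
      have h2 : coreSize (adjNat x) x.n ≤ x.n := countLT_le _ _
      omega
    rw [hk, deletionColorable_nthVertex (P := IsKept (adjNat x) x.n c) hA]
    · exact and_iff_right hs
    · intro i j
      rw [← hn]
      have : ∀ hi hj, (kernel c x).graph.Adj ⟨i, hi⟩ ⟨j, hj⟩ ↔
          adjNat x (nthVertex (IsKept (adjNat x) x.n c) x.n i)
            (nthVertex (IsKept (adjNat x) x.n c) x.n j) := by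
        intro hi hj
        change KernelAdj c x.encode i j ↔ _
        rw [KernelAdj, if_neg hr, wordAdj_encode_eq, wordSize_encode]
      constructor
      · rintro ⟨hi, hj, h⟩
        exact ⟨hi, hj, (this hi hj).1 h⟩
      · rintro ⟨hi, hj, h⟩
        exact ⟨hi, hj, (this hi hj).2 h⟩

/-! ### The size of the kernel -/

theorem twinCoverNum_le {n : ℕ} (G : SimpleGraph (Fin n)) : G.twinCoverNum ≤ n :=
  Nat.sInf_le ⟨Finset.univ, by
    rw [Finset.coe_univ]
    exact G.isTwinCover_univ, by simp⟩

theorem mem_map_val_iff {n : ℕ} {S : Finset (Fin n)} {w : ℕ} (hw : w < n) :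
    w ∈ S.map Fin.valEmbedding ↔ (⟨w, hw⟩ : Fin n) ∈ S :=
  Finset.mem_map' (f := Fin.valEmbedding) (a := ⟨w, hw⟩)

/-- A minimum twin-cover `S` covers all non-twin edges. Adjacent vertices outside `S` lie in one
component, so they agree on neighbours in `S` by definition and on the others because the component
is a clique. -/
theorem coreSize_le_twinCoverNum (x : GraphBudget) :
    coreSize (adjNat x) x.n ≤
      x.graph.twinCoverNum * x.graph.twinCoverNum + x.graph.twinCoverNum := by
  obtain ⟨S, ⟨hcl, hN⟩, hcard⟩ : x.graph.twinCoverNum ∈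
      {m : ℕ | ∃ S : Finset (Fin x.n), x.graph.IsTwinCover (S : Set (Fin x.n)) ∧ S.card = m} :=
    Nat.sInf_mem ⟨_, Finset.univ, by
      rw [Finset.coe_univ]
      exact x.graph.isTwinCover_univ, rfl⟩
  rw [← hcard, ← Finset.card_map (Fin.valEmbedding)]
  refine coreSize_le_of_cover (isGraphOn_adjNat x) _ ?_ ?_
  · rw [Finset.card_map]
    exact (Finset.card_le_univ S).trans (by simp)
  rintro u v ⟨⟨hu, hv, huv⟩, hnt⟩
  by_contra hcon
  rw [not_or] at hcon
  rw [mem_map_val_iff hu, mem_map_val_iff hv] at hcon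
  obtain ⟨huS, hvS⟩ := hcon
  set u' : ↥((S : Set (Fin x.n))ᶜ) := ⟨⟨u, hu⟩, by simpa using huS⟩ with hu'
  set v' : ↥((S : Set (Fin x.n))ᶜ) := ⟨⟨v, hv⟩, by simpa using hvS⟩ with hv'
  have hadj : (x.graph.induce (S : Set (Fin x.n))ᶜ).Adj u' v' := huv
  have hone : ∀ a b : ↥((S : Set (Fin x.n))ᶜ),
      (x.graph.induce (S : Set (Fin x.n))ᶜ).Adj a b → ∀ w : Fin x.n, w ≠ b →
      x.graph.Adj a w → x.graph.Adj b w := by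
    intro a b hab w hwb haw
    by_cases hw : w ∈ S
    · have h1 : w ∈ x.graph.neighborSet (a : Fin x.n) ∩ S := ⟨haw, hw⟩
      rw [hN a b hab.reachable] at h1
      exact h1.1
    · set w' : ↥((S : Set (Fin x.n))ᶜ) := ⟨w, by simpa using hw⟩
      have haw' : (x.graph.induce (S : Set (Fin x.n))ᶜ).Adj a w' := haw
      exact hcl b w' (hab.symm.reachable.trans haw'.reachable)
        fun h => hwb (congrArg Subtype.val h).symm
  refine hnt ⟨⟨hu, hv, huv⟩, fun w hw hwu hwv => ?_⟩
  constructor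
  · rintro ⟨_, _, h⟩
    exact ⟨hv, hw, hone u' v' hadj ⟨w, hw⟩ (fun h => hwv (congrArg Fin.val h)) h⟩
  · rintro ⟨_, _, h⟩
    exact ⟨hu, hw, hone v' u' hadj.symm ⟨w, hw⟩ (fun h => hwu (congrArg Fin.val h)) h⟩

theorem exists_polynomial_kernel_le {c : ℕ} (hc : c ≤ 2) :
    ∃ p : Polynomial ℕ, ∀ x : GraphBudget, (kernel c x).encode.length +
      (kernel c x).graph.twinCoverNum ≤ p.eval x.graph.twinCoverNum := by
  set q : Polynomial ℕ := Polynomial.X * Polynomial.X + Polynomial.X with hq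
  -- The summand `3` accounts for the triangle of rejected instances; the parameter of the kernel is
  -- bounded by its number of vertices.
  set r : Polynomial ℕ := q + 4 * (q * q) * (q + 1) + 3 with hr
  refine ⟨r + 1 + r * r + q + r, fun x => ?_⟩
  have hcore : coreSize (adjNat x) x.n ≤ q.eval x.graph.twinCoverNum := by
    simpa [hq] using coreSize_le_twinCoverNum x
  generalize x.graph.twinCoverNum = τ at *
  have hn : (kernel c x).n ≤ r.eval τ := by
    change kernelSize c x.encode ≤ _
    rw [kernelSize]
    have h1 := countLT_isKept_le (isGraphOn_adjNat x) hc
    have h2 : r.eval τ = q.eval τ + 4 * (q.eval τ * q.eval τ) * (q.eval τ + 1) + 3 := by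
      simp [hr]
    rw [h2]
    split_ifs
    · omega
    · rw [wordAdj_encode_eq, wordSize_encode]
      refine h1.trans (le_trans ?_ (Nat.le_add_right _ 3))
      gcongr
  have hk : (kernel c x).budget ≤ q.eval τ := by
    change kernelBudget c x.encode ≤ _
    rw [kernelBudget]
    split_ifs
    · exact Nat.zero_le _
    · rw [wordAdj_encode_eq, wordSize_encode]
      exact (min_le_right _ _).trans hcore
  have hs : Nat.size (kernel c x).budget ≤ (kernel c x).budget :=
    Nat.size_le.2 Nat.lt_two_pow_self
  have htc := twinCoverNum_le (kernel c x).graph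
  have hnn := Nat.mul_le_mul hn hn
  rw [length_encode]
  simp only [Polynomial.eval_add, Polynomial.eval_mul, Polynomial.eval_one]
  omega

/-! ### Vertex covers and odd cycle transversals -/

theorem deletionColorable_adjNat_iff (x : GraphBudget) {c : ℕ} (hc : 0 < c) :
    DeletionColorable (adjNat x) c (fun _ => True) x.budget ↔
      ∃ S : Finset (Fin x.n), (∃ col : Fin x.n → ℕ, (∀ v, col v < c) ∧
        ∀ u v, x.graph.Adj u v → u ∉ S → v ∉ S → col u ≠ col v) ∧ S.card ≤ x.budget := by
  classical
  constructor
  · rintro ⟨X, hX, col, hcol, h⟩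
    refine ⟨Finset.univ.filter fun v : Fin x.n => v.1 ∈ X, ⟨fun v => col v, fun v => hcol _,
      fun u v huv hu hv => h u v ⟨u.2, v.2, huv⟩ trivial trivial (by simpa using hu)
        (by simpa using hv)⟩, le_trans ?_ hX⟩
    exact Finset.card_le_card_of_injOn Fin.val (fun v hv => by simpa using hv)
      fun u _ v _ h => Fin.ext h
  · rintro ⟨S, ⟨col, hcol, h⟩, hS⟩
    refine ⟨S.map Fin.valEmbedding, by rwa [Finset.card_map],
      fun v => if hv : v < x.n then col ⟨v, hv⟩ else 0, fun v => ?_, ?_⟩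
    · dsimp only
      split_ifs
      · exact hcol _
      · exact hc
    · rintro u v ⟨hu, hv, huv⟩ - - huS hvS
      simp only [hu, hv, dif_pos]
      exact h _ _ huv (fun hc => huS ((mem_map_val_iff hu).2 hc))
        fun hc => hvS ((mem_map_val_iff hv).2 hc)

/-- A graph has a proper colouring with one colour exactly if it has no edges. -/
theorem vertexCover_isYes_iff (x : GraphBudget) : vertexCoverByTwinCover.IsYes x ↔
    DeletionColorable (adjNat x) 1 (fun _ => True) x.budget := by
  rw [deletionColorable_adjNat_iff x one_pos]
  refine exists_congr fun S => and_congr_left fun _ => ⟨fun h => ?_, ?_⟩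
  · exact ⟨fun _ => 0, fun _ => one_pos, fun u v huv hu hv => absurd (h huv) (by simp [hu, hv])⟩
  · rintro ⟨col, hcol, h⟩ u v huv
    by_contra hcon
    rw [not_or, Finset.mem_coe, Finset.mem_coe] at hcon
    have h1 := h u v huv hcon.1 hcon.2
    have h2 := hcol u
    have h3 := hcol v
    omega

theorem oddCycleTransversal_isYes_iff (x : GraphBudget) :
    oddCycleTransversalByTwinCover.IsYes x ↔
      DeletionColorable (adjNat x) 2 (fun _ => True) x.budget := by
  classical
  rw [deletionColorable_adjNat_iff x two_pos]
  refine exists_congr fun S => and_congr_left fun _ => ⟨?_, ?_⟩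
  · rintro ⟨C⟩
    refine ⟨fun v => if h : v ∉ S then (C ⟨v, by simpa using h⟩ : Fin 2) else 0, fun v => ?_,
      fun u v huv hu hv he => ?_⟩
    · dsimp only
      split_ifs
      · exact two_pos
      · exact Fin.is_lt _
    · simp only [dif_pos hu, dif_pos hv] at he
      exact C.valid (show (x.graph.induce (S : Set (Fin x.n))ᶜ).Adj ⟨u, by simpa using hu⟩
        ⟨v, by simpa using hv⟩ from huv) (Fin.ext he)
  · rintro ⟨col, hcol, h⟩
    refine ⟨SimpleGraph.Coloring.mk (fun v => (⟨col v, hcol v⟩ : Fin 2)) fun {u v} huv he => ?_⟩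
    exact h u v huv (fun hc => u.2 (Finset.mem_coe.2 hc))
      (fun hc => v.2 (Finset.mem_coe.2 hc)) (congrArg Fin.val he)

end TwinKernel

theorem mainTheorem12 :
    vertexCoverByTwinCover.HasPolynomialKernel ∧
      oddCycleTransversalByTwinCover.HasPolynomialKernel := by
  open TwinKernel in
  refine ⟨⟨kernel 1, kernel_tm2ComputableInPolyTime 1, fun x => ?_,
    exists_polynomial_kernel_le (by omega)⟩, ⟨kernel 2, kernel_tm2ComputableInPolyTime 2,
    fun x => ?_, exists_polynomial_kernel_le le_rfl⟩⟩
  · exact (vertexCover_isYes_iff x).trans ((deletionColorable_kernel (Or.inl rfl) x).trans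
      (vertexCover_isYes_iff (kernel 1 x)).symm)
  · exact (oddCycleTransversal_isYes_iff x).trans ((deletionColorable_kernel (Or.inr rfl) x).trans
      (oddCycleTransversal_isYes_iff (kernel 2 x)).symm)
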